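/- Let $\mathbb D$ be the open unit disk in $\mathbb C$, $dA$ the normalized area measure on $\mathbb D$ and, for $\alpha>-1$, $dA_\alpha(z)=(\alpha+1)(1-|z|^2)^\alpha\,dA(z)$. For $p>0$ let $A^p_\alpha(\mathbb D)$ be the space of holomorphic functions $f$ on $\mathbb D$ with $\|f\|_{p,\alpha}=\bigl(\int_{\mathbb D}|f|^p\,dA_\alpha\bigr)^{1/p}<\infty$, and let $A^p_\alpha(\mathbb D^2)$ be the space of holomorphic functions $F$ on the bidisk $\mathbb D^2=\mathbb D\times\mathbb D$ with $\|F\|_{p,\alpha}=\bigl(\int_{\mathbb D}\int_{\mathbb D}|F(z,w)|^p\,dA_\alpha(z)\,dA_\alpha(w)\bigr)^{1/p}<\infty$. For $f$ holomorphic on $\mathbb D$ define the symmetric lifting $$(Lf)(z,w)=\frac{f(z)-f(w)}{z-w}\quad(z\ne w),\qquad (Lf)(z,z)=f'(z).$$ Suppose $\alpha>-1$ and $p>0$. (i) If $p<\alpha+2$, then $L$ maps $A^p_\alpha(\mathbb D)$ boundedly into $A^p_\alpha(\mathbb D^2)$: there is a constant $C$, depending only on $p$ and $\alpha$, such that for every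 $f\in A^p_\alpha(\mathbb D)$ one has $Lf\in A^p_\alpha(\mathbb D^2)$ and $\|Lf\|_{p,\alpha}\le C\|f\|_{p,\alpha}$. (ii) If $p>\alpha+2$, this fails: there is $f\in A^p_\alpha(\mathbb D)$ such that $Lf\notin A^p_\alpha(\mathbb D^2)$. -/

import Mathlib

open MeasureTheory
open scoped ENNReal NNReal

noncomputable section

/-- The open unit disk `𝔻` in `ℂ`. -/
def unitDisk : Set ℂ := Metric.ball 0 1

/-- The normalized area measure `dA` on the unit disk, as a measure on `ℂ` carried by `𝔻`. -/
def normalizedArea : Measure ℂ := (ENNReal.ofReal Real.pi)⁻¹ • volume.restrict unitDisk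

/-- The weighted area measure `dA_α(z) = (α + 1) (1 - |z|²)^α dA(z)` on the unit disk. -/
def weightedArea (α : ℝ) : Measure ℂ :=
  normalizedArea.withDensity fun z => ENNReal.ofReal ((α + 1) * (1 - ‖z‖ ^ 2) ^ α)

/-- The weighted Bergman space `A^p_α(𝔻)`: functions holomorphic in `𝔻` that lie in
`L^p(𝔻, dA_α)`. Values outside `𝔻` play no role. -/
def bergmanDisk (p α : ℝ) : Set (ℂ → ℂ) :=
  {f | DifferentiableOn ℂ f unitDisk ∧ MemLp f (ENNReal.ofReal p) (weightedArea α)}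

/-- The weighted Bergman space `A^p_α(𝔻²)`: functions holomorphic in the bidisk `𝔻²` that lie in
`L^p(𝔻², dA_α × dA_α)`. Values outside `𝔻²` play no role. -/
def bergmanBidisk (p α : ℝ) : Set (ℂ × ℂ → ℂ) :=
  {F | DifferentiableOn ℂ F (unitDisk ×ˢ unitDisk) ∧
    MemLp F (ENNReal.ofReal p) ((weightedArea α).prod (weightedArea α))}

/-- The (quasi-)norm `(∫ |f|^p dA_α)^{1/p}` of `A^p_α(𝔻)`. -/
def bergmanDiskNorm (p α : ℝ) (f : ℂ → ℂ) : ℝ≥0∞ :=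
  eLpNorm f (ENNReal.ofReal p) (weightedArea α)

/-- The (quasi-)norm `(∫∫ |F|^p dA_α dA_α)^{1/p}` of `A^p_α(𝔻²)`. -/
def bergmanBidiskNorm (p α : ℝ) (F : ℂ × ℂ → ℂ) : ℝ≥0∞ :=
  eLpNorm F (ENNReal.ofReal p) ((weightedArea α).prod (weightedArea α))

open scoped Classical in
/-- The symmetric lifting operator `L f (z, w) = (f z - f w) / (z - w)`, with the limiting value
`f' z` on the diagonal `z = w`. -/
def symmetricLift (f : ℂ → ℂ) : ℂ × ℂ → ℂ := fun x =>
  if x.1 = x.2 then deriv f x.1 else (f x.1 - f x.2) / (x.1 - x.2)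

end

/-! Write `h(z) = 1 - |z|²`. For `p < α + 2` the bidisk is cut according to whether `|z - w|` is
smaller than `h(z)/64`.

Far from the diagonal, `|Lf(z,w)|^p` is at most a constant times `|z - w|^(-p) (|f(z)|^p +
|f(w)|^p)`. There both `h(z)` and `h(w)` are bounded by a multiple of `|z - w|`, and on such pairs
the kernel `|z - w|^(-p)` has `dA_α`-integrals in either variable bounded uniformly in the other,
exactly because `p < α + 2` (`exists_lintegral_kernel_le`). Tonelli and the symmetry of the kernel
finish this part.

Near the diagonal, `Lf` is controlled by `f'`. Subharmonicity of `|f|^p`, valid for every `p > 0`,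
and Cauchy's estimate bound `|f'|^p` by `h(z)^(-p)` times an average of `|f|^p` over a disc of
radius comparable to `h(z)` (`enorm_symmetricLift_rpow_le`). Integrating in `w` and then exchanging
the order of integration produces the weight `h^(α+2-p) ≤ 1` (`lintegral_lintegral_ball_le`).

For `p > α + 2` the function `f(z) = (1 - z)^(-c)` is a counterexample when `cp` is just below `α +
2`. For `z` near `1 - t` and `w` near `1 - 4t` one has `|Lf| ≳ t^(-c-1)` on a set of measure about
`t^(2(α+2))`. As `t → 0` these sets shrink to measure zero, yet each carries a fixed amount of `∫∫
|Lf|^p`, so that integral diverges. -/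

/-! ### Sub-mean value property of `|f|^p`. -/

/-- Hardy's convexity inequality: `‖f‖ ^ p` is subharmonic for every `p > 0`. -/
theorem norm_rpow_le_circleAverage {f : ℂ → ℂ} {c : ℂ} {R p : ℝ} (hR : R ≠ 0) (hp : 0 < p)
    (hf : AnalyticOnNhd ℂ f (Metric.closedBall c |R|)) :
    ‖f c‖ ^ p ≤ Real.circleAverage (fun z => ‖f z‖ ^ p) c R := by
  have hfs : AnalyticOnNhd ℂ f (Metric.sphere c |R|) := hf.mono Metric.sphere_subset_closedBall
  have hcont : ContinuousOn (fun z => ‖f z‖ ^ p) (Metric.sphere c |R|) :=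
    hfs.continuousOn.norm.rpow_const fun _ _ => Or.inr hp.le
  have hint : CircleIntegrable (fun z => ‖f z‖ ^ p) c R := hcont.circleIntegrable'
  by_cases h0 : f c = 0
  · rw [h0, norm_zero, Real.zero_rpow hp.ne']
    exact Real.circleAverage_nonneg_of_nonneg fun z _ => by positivity
  have hn : 0 < ‖f c‖ := norm_pos_iff.2 h0
  -- The elementary bound `log x ≤ x^p / (p e)` is an equality at `x = e^(1/p)`. The scaling `l`
  -- moves `|f c|` to that point, so nothing is lost at the centre when the bound is averaged in
  -- Jensen's formula.
  set l : ℝ := Real.exp (1 / p) / ‖f c‖ with hl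
  have hlpos : 0 < l := by positivity
  have hga : AnalyticOnNhd ℂ (fun z => (l : ℂ) * f z) (Metric.closedBall c |R|) :=
    fun z hz => analyticAt_const.mul (hf z hz)
  have hgn : ∀ z, ‖(l : ℂ) * f z‖ = l * ‖f z‖ := fun z => by
    rw [norm_mul, Complex.norm_real, Real.norm_of_nonneg hlpos.le]
  have hgc : ‖(l : ℂ) * f c‖ = Real.exp (1 / p) := by
    rw [hgn, hl]; field_simp
  have hJ := hga.circleAverage_log_norm hR
    (by simpa using ⟨hlpos.ne', h0⟩)
  -- The zeros contribute nonnegative terms to Jensen's formula: `l f` has no poles and each zero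
  -- `u` satisfies `|c - u| ≤ |R|`.
  have hsum : 0 ≤ ∑ᶠ u, MeromorphicOn.divisor (fun z => (l : ℂ) * f z)
      (Metric.closedBall c |R|) u * Real.log (R * ‖c - u‖⁻¹) := by
    refine finsum_nonneg fun u => ?_
    by_cases hu : u ∈ Metric.closedBall c |R|
    · refine mul_nonneg (mod_cast MeromorphicOn.AnalyticOnNhd.divisor_nonneg hga u) ?_
      rcases eq_or_ne u c with rfl | huc
      · simp
      have h1 : 0 < ‖c - u‖ := norm_pos_iff.2 (sub_ne_zero.2 huc.symm)
      rw [Metric.mem_closedBall, dist_eq_norm, norm_sub_rev] at hu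
      rw [← Real.log_abs, abs_mul, abs_inv, abs_norm]
      refine Real.log_nonneg ?_
      rw [← div_eq_mul_inv]
      exact (one_le_div h1).2 hu
    · simp [hu]
  have hlow : 1 / p ≤ Real.circleAverage (fun z => Real.log ‖(l : ℂ) * f z‖) c R := by
    rw [hJ, hgc, Real.log_exp]; linarith
  have hpt : ∀ z ∈ Metric.sphere c |R|,
      Real.log ‖(l : ℂ) * f z‖ ≤ (l ^ p * (p * Real.exp 1)⁻¹) • ‖f z‖ ^ p := by
    intro z _
    rw [hgn, smul_eq_mul]
    rcases (norm_nonneg (f z)).eq_or_lt with h | h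
    · rw [← h]; simp [Real.zero_rpow hp.ne']
    · have hy : 0 < (l * ‖f z‖) ^ p := by positivity
      -- With `y = (l |f z|)^p`, this is `log y ≤ y / e`.
      have := Real.add_one_le_exp (p * Real.log (l * ‖f z‖) - 1)
      rw [Real.exp_sub, mul_comm p, Real.exp_mul, Real.exp_log (by positivity)] at this
      rw [Real.mul_rpow hlpos.le h.le] at this
      rw [mul_inv]
      have e1 : 0 < Real.exp 1 := Real.exp_pos 1
      have h2 : Real.log (l * ‖f z‖) * p ≤ l ^ p * ‖f z‖ ^ p / Real.exp 1 := by linarith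
      calc Real.log (l * ‖f z‖) = Real.log (l * ‖f z‖) * p * p⁻¹ := by field_simp
        _ ≤ l ^ p * ‖f z‖ ^ p / Real.exp 1 * p⁻¹ := by gcongr
        _ = _ := by ring
  have hmono := Real.circleAverage_mono
    ((hga.mono Metric.sphere_subset_closedBall).meromorphicOn.circleIntegrable_log_norm)
    (hint.const_smul (a := l ^ p * (p * Real.exp 1)⁻¹)) hpt
  have hsm : Real.circleAverage ((l ^ p * (p * Real.exp 1)⁻¹) • (fun z => ‖f z‖ ^ p)) c R =
      (l ^ p * (p * Real.exp 1)⁻¹) • Real.circleAverage (fun z => ‖f z‖ ^ p) c R :=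
    Real.circleAverage_smul
  rw [hsm, smul_eq_mul] at hmono
  have h3 := hlow.trans hmono
  have hlp : l ^ p = Real.exp 1 / ‖f c‖ ^ p := by
    rw [hl, Real.div_rpow (by positivity) hn.le, ← Real.exp_mul]; field_simp
  rw [hlp] at h3
  have hnp : 0 < ‖f c‖ ^ p := by positivity
  have h4 : 1 / p * (p * ‖f c‖ ^ p) ≤ Real.exp 1 / ‖f c‖ ^ p * (p * Real.exp 1)⁻¹ *
      Real.circleAverage (fun z => ‖f z‖ ^ p) c R * (p * ‖f c‖ ^ p) :=
    mul_le_mul_of_nonneg_right h3 (by positivity)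
  have h5 : Real.exp 1 / ‖f c‖ ^ p * (p * Real.exp 1)⁻¹ *
      Real.circleAverage (fun z => ‖f z‖ ^ p) c R * (p * ‖f c‖ ^ p) =
      Real.circleAverage (fun z => ‖f z‖ ^ p) c R := by field_simp
  have h6 : 1 / p * (p * ‖f c‖ ^ p) = ‖f c‖ ^ p := by field_simp
  linarith

theorem lintegral_circle_enorm_rpow_ge {f : ℂ → ℂ} {c : ℂ} {R p : ℝ} (hR : R ≠ 0) (hp : 0 < p)
    (hf : AnalyticOnNhd ℂ f (Metric.closedBall c |R|)) :
    ENNReal.ofReal (2 * Real.pi) * ‖f c‖ₑ ^ p ≤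
      ∫⁻ θ in Set.Ioo (-Real.pi) Real.pi, ‖f (circleMap c R θ)‖ₑ ^ p := by
  have h := norm_rpow_le_circleAverage hR hp hf
  rw [Real.circleAverage_eq_integral_add (-Real.pi), smul_eq_mul,
    intervalIntegral.integral_comp_add_right (fun θ => ‖f (circleMap c R θ)‖ ^ p),
    inv_mul_eq_div, le_div_iff₀ (by positivity)] at h
  rw [show 0 + -Real.pi = -Real.pi by ring, show 2 * Real.pi + -Real.pi = Real.pi by ring,
    intervalIntegral.integral_of_le (by linarith [Real.pi_pos]), integral_Ioc_eq_integral_Ioo] at h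
  have hfs : ContinuousOn f (Metric.sphere c |R|) :=
    (hf.mono Metric.sphere_subset_closedBall).continuousOn
  have hc : Continuous fun θ => ‖f (circleMap c R θ)‖ ^ p := by
    refine Continuous.rpow_const ?_ fun _ => Or.inr hp.le
    exact (hfs.comp_continuous (continuous_circleMap c R) (circleMap_mem_sphere' c R)).norm
  have hi : IntegrableOn (fun θ => ‖f (circleMap c R θ)‖ ^ p) (Set.Ioo (-Real.pi) Real.pi) :=
    (hc.integrableOn_Icc (a := -Real.pi) (b := Real.pi)).mono_set Set.Ioo_subset_Icc_self
  calc ENNReal.ofReal (2 * Real.pi) * ‖f c‖ₑ ^ p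
      = ENNReal.ofReal (‖f c‖ ^ p * (2 * Real.pi)) := by
        rw [mul_comm, ENNReal.ofReal_mul (p := ‖f c‖ ^ p) (by positivity), ← ofReal_norm,
          ENNReal.ofReal_rpow_of_nonneg (norm_nonneg _) hp.le]
    _ ≤ ENNReal.ofReal (∫ θ in Set.Ioo (-Real.pi) Real.pi, ‖f (circleMap c R θ)‖ ^ p) :=
        ENNReal.ofReal_le_ofReal h
    _ = ∫⁻ θ in Set.Ioo (-Real.pi) Real.pi, ENNReal.ofReal (‖f (circleMap c R θ)‖ ^ p) :=
        ofReal_integral_eq_lintegral_ofReal hi (ae_of_all _ fun _ => by positivity)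
    _ = _ := by
        refine lintegral_congr fun θ => ?_
        rw [← ofReal_norm, ENNReal.ofReal_rpow_of_nonneg (norm_nonneg _) hp.le]

theorem measurable_indicator_enorm_rpow {f : ℂ → ℂ} {s : Set ℂ} (hs : MeasurableSet s)
    (hf : ContinuousOn f s) (p : ℝ) : Measurable (s.indicator fun z => ‖f z‖ₑ ^ p) := by
  classical
  rw [← Set.piecewise_eq_indicator]
  refine ContinuousOn.measurable_piecewise ?_ continuousOn_const hs
  exact (ENNReal.continuous_rpow_const.comp_continuousOn hf.enorm)

/-- The circle inequality is multiplied by the radius and integrated in polar coordinates centred at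
`c`. -/
theorem enorm_rpow_le_lintegral_ball {f : ℂ → ℂ} {c : ℂ} {r p : ℝ} (hr : 0 < r) (hp : 0 < p)
    (hf : DifferentiableOn ℂ f (Metric.ball c r)) :
    ENNReal.ofReal (Real.pi * r ^ 2) * ‖f c‖ₑ ^ p ≤ ∫⁻ z in Metric.ball c r, ‖f z‖ₑ ^ p := by
  have hfa : AnalyticOnNhd ℂ f (Metric.ball c r) := hf.analyticOnNhd Metric.isOpen_ball
  set G := (Metric.ball c r).indicator fun z => ‖f z‖ₑ ^ p with hG
  have hGm : Measurable G :=
    measurable_indicator_enorm_rpow measurableSet_ball hf.continuousOn p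
  rw [← lintegral_indicator measurableSet_ball, ← hG, ← lintegral_add_left_eq_self G c,
    ← Complex.lintegral_comp_polarCoord_symm, polarCoord_target, Measure.volume_eq_prod,
    ← Measure.prod_restrict, lintegral_prod]
  swap
  · refine Measurable.aemeasurable ?_
    refine (ENNReal.measurable_ofReal.comp measurable_fst).smul (hGm.comp ?_)
    simp only [Complex.polarCoord_symm_apply]
    fun_prop
  have hcirc : ∀ ρ θ : ℝ, c + Complex.polarCoord.symm (ρ, θ) = circleMap c ρ θ := by
    intro ρ θ
    simp [circleMap, Complex.exp_mul_I]
  have hi : ∫⁻ ρ in Set.Ioo 0 r, ENNReal.ofReal ρ = ENNReal.ofReal (r ^ 2 / 2) := by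
    rw [← ofReal_integral_eq_lintegral_ofReal]
    · rw [← integral_Ioc_eq_integral_Ioo, ← intervalIntegral.integral_of_le hr.le, integral_id]
      simp
    · exact (continuous_id.integrableOn_Icc (a := 0) (b := r)).mono_set Set.Ioo_subset_Icc_self
    · filter_upwards [self_mem_ae_restrict measurableSet_Ioo] with x hx using hx.1.le
  calc ENNReal.ofReal (Real.pi * r ^ 2) * ‖f c‖ₑ ^ p
      = ∫⁻ ρ in Set.Ioo 0 r, ENNReal.ofReal ρ * (ENNReal.ofReal (2 * Real.pi) * ‖f c‖ₑ ^ p) := by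
        rw [lintegral_mul_const _ ENNReal.measurable_ofReal, hi, ← mul_assoc,
          ← ENNReal.ofReal_mul (by positivity)]
        congr 2; ring
    _ ≤ ∫⁻ ρ in Set.Ioo 0 r, ∫⁻ θ in Set.Ioo (-Real.pi) Real.pi,
          ENNReal.ofReal ρ * G (circleMap c ρ θ) := by
        refine setLIntegral_mono' measurableSet_Ioo fun ρ hρ => ?_
        rw [lintegral_const_mul (ENNReal.ofReal ρ) (f := fun θ => G (circleMap c ρ θ))
          (hGm.comp (continuous_circleMap c ρ).measurable)]
        gcongr
        have hsub : Metric.closedBall c |ρ| ⊆ Metric.ball c r :=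
          Metric.closedBall_subset_ball (by rw [abs_of_pos hρ.1]; exact hρ.2)
        refine (lintegral_circle_enorm_rpow_ge hρ.1.ne' hp (hfa.mono hsub)).trans_eq ?_
        refine lintegral_congr fun θ => ?_
        rw [hG, Set.indicator_of_mem]
        exact hsub (Metric.sphere_subset_closedBall (circleMap_mem_sphere' c ρ θ))
    _ ≤ ∫⁻ ρ in Set.Ioi 0, ∫⁻ θ in Set.Ioo (-Real.pi) Real.pi,
          ENNReal.ofReal ρ * G (circleMap c ρ θ) :=
        lintegral_mono_set Set.Ioo_subset_Ioi_self
    _ = _ := by simp only [hcirc, smul_eq_mul]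

/-! ### Uniform integrability of the kernel `|z - w|^(-q)` on the disk. -/

theorem isOpen_unitDisk : IsOpen unitDisk := Metric.isOpen_ball

theorem measurableSet_unitDisk : MeasurableSet unitDisk := isOpen_unitDisk.measurableSet

theorem mem_unitDisk {z : ℂ} : z ∈ unitDisk ↔ ‖z‖ < 1 := mem_ball_zero_iff

theorem lintegral_enorm_rpow_neg_lt_top {b : ℝ} (hb : b < 1) (A : ℝ) :
    ∫⁻ t in Set.Ioo (-A) A, ‖t‖ₑ ^ (-b) < ⊤ := by
  rcases le_or_gt A 0 with hA | hA
  · rw [Set.Ioo_eq_empty (by linarith)]; simp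
  -- The complex power is integrable on both sides of `0` at once, and its norm is `|x|^(-b)` for
  -- real `x ≠ 0`.
  have h : IntervalIntegrable (fun x : ℝ => (x : ℂ) ^ ((-b : ℝ) : ℂ)) volume (-A) A :=
    intervalIntegral.intervalIntegrable_cpow' (by rw [Complex.ofReal_re]; linarith)
  have h2 : IntegrableOn (fun x : ℝ => (x : ℂ) ^ ((-b : ℝ) : ℂ)) (Set.Ioo (-A) A) :=
    ((intervalIntegrable_iff_integrableOn_Ioc_of_le (by linarith)).1 h).mono_set
      Set.Ioo_subset_Ioc_self
  refine lt_of_eq_of_lt (lintegral_congr_ae ?_) h2.2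
  have h0 : ∀ᵐ x : ℝ ∂(volume.restrict (Set.Ioo (-A) A)), x ≠ 0 :=
    ae_restrict_of_ae (Measure.ae_ne volume 0)
  filter_upwards [h0] with x hx
  rw [← ofReal_norm, ← ofReal_norm, Complex.norm_cpow_real, Complex.norm_real,
    ENNReal.ofReal_rpow_of_pos (norm_pos_iff.2 hx)]

/-- Jordan's inequality `|sin t| ≥ (2/π)|t|` on `|t| ≤ π/2` handles the zero at `0`. Translation by
`±π` handles the zeros at the endpoints. -/
theorem lintegral_enorm_sin_rpow_neg_lt_top {b : ℝ} (hb0 : 0 ≤ b) (hb : b < 1) :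
    ∫⁻ θ in Set.Ioo (-Real.pi) Real.pi, ‖Real.sin θ‖ₑ ^ (-b) < ⊤ := by
  set E : ℝ → ℝ≥0∞ := (Set.Ioo (-(2 * Real.pi)) (2 * Real.pi)).indicator fun t => ‖t‖ₑ ^ (-b)
    with hE
  have hEm : Measurable E := Measurable.indicator (by fun_prop) measurableSet_Ioo
  have hEf : ∫⁻ t, E t < ⊤ := by
    rw [hE, lintegral_indicator measurableSet_Ioo]
    exact lintegral_enorm_rpow_neg_lt_top hb _
  set K : ℝ≥0∞ := ENNReal.ofReal (2 / Real.pi) ^ (-b) with hK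
  have hπ := Real.pi_pos
  have hKt : K ≠ ⊤ := by
    rw [hK, ENNReal.ofReal_rpow_of_pos (by positivity)]
    exact ENNReal.ofReal_ne_top
  have hsin : ∀ t : ℝ, |t| ≤ Real.pi / 2 → ‖Real.sin t‖ₑ ^ (-b) ≤ K * E t := by
    intro t ht
    have ht' := abs_le.1 ht
    rw [hE, Set.indicator_of_mem (by constructor <;> linarith [ht'.1, ht'.2]), hK,
      ← ENNReal.mul_rpow_of_ne_top ENNReal.ofReal_ne_top enorm_ne_top]
    rw [ENNReal.rpow_neg, ENNReal.rpow_neg, ENNReal.inv_le_inv]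
    refine ENNReal.rpow_le_rpow ?_ hb0
    rw [← ofReal_norm, ← ofReal_norm, ← ENNReal.ofReal_mul (by positivity)]
    exact ENNReal.ofReal_le_ofReal (Real.mul_abs_le_abs_sin ht)
  have hpt : ∀ θ ∈ Set.Ioo (-Real.pi) Real.pi,
      ‖Real.sin θ‖ₑ ^ (-b) ≤ K * E θ + K * E (θ - Real.pi) + K * E (θ - -Real.pi) := by
    intro θ hθ
    rcases le_or_gt θ (-(Real.pi / 2)) with h1 | h1
    · have := hsin (θ - -Real.pi) (by rw [abs_le]; constructor <;> linarith [hθ.1])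
      rw [sub_neg_eq_add, Real.sin_add_pi, enorm_neg] at this
      rw [sub_neg_eq_add]
      exact this.trans le_add_self
    rcases le_or_gt θ (Real.pi / 2) with h2 | h2
    · exact (hsin θ (by rw [abs_le]; constructor <;> linarith)).trans
        (le_self_add.trans le_self_add)
    · have := hsin (θ - Real.pi) (by rw [abs_le]; constructor <;> linarith [hθ.2])
      rw [Real.sin_sub_pi, enorm_neg] at this
      exact this.trans (le_add_self.trans le_self_add)
  calc ∫⁻ θ in Set.Ioo (-Real.pi) Real.pi, ‖Real.sin θ‖ₑ ^ (-b)
      ≤ ∫⁻ θ in Set.Ioo (-Real.pi) Real.pi,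
          (K * E θ + K * E (θ - Real.pi) + K * E (θ - -Real.pi)) :=
        setLIntegral_mono' measurableSet_Ioo hpt
    _ ≤ ∫⁻ θ, (K * E θ + K * E (θ - Real.pi) + K * E (θ - -Real.pi)) := setLIntegral_le_lintegral _ _
    _ = K * (∫⁻ t, E t) + K * (∫⁻ t, E t) + K * (∫⁻ t, E t) := by
        rw [lintegral_add_left (by fun_prop), lintegral_add_left (by fun_prop),
          lintegral_const_mul _ hEm, lintegral_const_mul _ (by fun_prop),
          lintegral_const_mul _ (by fun_prop), lintegral_sub_right_eq_self E,
          lintegral_sub_right_eq_self E]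
    _ < ⊤ := by
        have := ENNReal.mul_lt_top hKt.lt_top hEf
        exact ENNReal.add_lt_top.2 ⟨ENNReal.add_lt_top.2 ⟨this, this⟩, this⟩

theorem lintegral_one_sub_rpow_lt_top {β : ℝ} (hβ : -1 < β) :
    ∫⁻ ρ in Set.Ioo (0 : ℝ) 1, ENNReal.ofReal ((1 - ρ) ^ β) < ⊤ := by
  have h := (intervalIntegral.intervalIntegrable_rpow' hβ (a := 0) (b := 1)).comp_sub_left 1
  have h2 := ((intervalIntegrable_iff_integrableOn_Ioc_of_le (by simp)).1 (by simpa using h.symm)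
    : IntegrableOn (fun x : ℝ => (1 - x) ^ β) (Set.Ioc 0 1))
  exact (lintegral_mono fun x => Real.ofReal_le_enorm _).trans_lt
    (h2.mono_set Set.Ioo_subset_Ioc_self).2

/-- In polar coordinates the integrand is dominated by a product of a function of `ρ` and one of
`θ`: the factor `1 + ρ` of `1 - ρ²` is harmless, and the Jacobian absorbs `ρ^(-b)` since `ρ · ρ^(-b)
≤ 1`. -/
theorem lintegral_disk_mul_enorm_im_lt_top {β b : ℝ} (hβ : -1 < β) (hb0 : 0 ≤ b) (hb : b < 1) :
    ∫⁻ w in unitDisk, ENNReal.ofReal ((1 - ‖w‖ ^ 2) ^ β) * ‖w.im‖ₑ ^ (-b) < ⊤ := by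
  set A : ℝ → ℝ≥0∞ := (Set.Ioo (0 : ℝ) 1).indicator fun ρ =>
    ENNReal.ofReal (2 ^ |β|) * ENNReal.ofReal ((1 - ρ) ^ β) with hA
  set B : ℝ → ℝ≥0∞ := fun θ => ‖Real.sin θ‖ₑ ^ (-b) with hB
  have hmA : Measurable A := Measurable.indicator (by fun_prop) measurableSet_Ioo
  have hmB : Measurable B := by fun_prop
  rw [unitDisk, ← lintegral_indicator measurableSet_ball, ← Complex.lintegral_comp_polarCoord_symm]
  have hle : ∀ x ∈ polarCoord.target, ENNReal.ofReal x.1 • (Metric.ball (0 : ℂ) 1).indicator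
      (fun w : ℂ => ENNReal.ofReal ((1 - ‖w‖ ^ 2) ^ β) * ‖w.im‖ₑ ^ (-b))
        (Complex.polarCoord.symm x) ≤ A x.1 * B x.2 := by
    rintro ⟨ρ, θ⟩ hx
    have hρ : 0 < ρ := hx.1
    have hn : ‖(Complex.polarCoord.symm (ρ, θ) : ℂ)‖ = ρ := by
      rw [Complex.norm_polarCoord_symm, abs_of_pos hρ]
    by_cases h1 : ρ < 1
    · rw [Set.indicator_of_mem (by rw [mem_ball_zero_iff, hn]; exact h1), hn, hA,
        Set.indicator_of_mem (show ρ ∈ Set.Ioo (0 : ℝ) 1 from ⟨hρ, h1⟩)]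
      have him : (Complex.polarCoord.symm (ρ, θ) : ℂ).im = ρ * Real.sin θ := by
        simp [Complex.polarCoord_symm_apply, Complex.sin_ofReal_re, Complex.cos_ofReal_im]
      have hpow : (1 - ρ ^ 2) ^ β ≤ 2 ^ |β| * (1 - ρ) ^ β := by
        rw [show 1 - ρ ^ 2 = (1 + ρ) * (1 - ρ) by ring,
          Real.mul_rpow (by linarith) (by linarith)]
        have h3 : (1 + ρ) ^ β ≤ 2 ^ |β| :=
          (Real.rpow_le_rpow_of_exponent_le (by linarith) (le_abs_self β)).trans
            (Real.rpow_le_rpow (by linarith) (by linarith) (abs_nonneg β))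
        have h4 : 0 ≤ (1 - ρ) ^ β := Real.rpow_nonneg (by linarith) _
        gcongr
      have hρb : ENNReal.ofReal ρ * ‖ρ‖ₑ ^ (-b) ≤ 1 := by
        rw [← ofReal_norm, Real.norm_of_nonneg hρ.le, ENNReal.ofReal_rpow_of_pos hρ,
          ← ENNReal.ofReal_mul hρ.le, ← ENNReal.ofReal_one]
        refine ENNReal.ofReal_le_ofReal ?_
        nth_rewrite 1 [← Real.rpow_one ρ]
        rw [← Real.rpow_add hρ]
        exact Real.rpow_le_one hρ.le h1.le (by linarith)
      rw [him, enorm_mul, ENNReal.mul_rpow_of_ne_top enorm_ne_top enorm_ne_top, smul_eq_mul]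
      calc _ = ENNReal.ofReal ((1 - ρ ^ 2) ^ β) * (ENNReal.ofReal ρ * ‖ρ‖ₑ ^ (-b)) * B θ := by
            rw [hB]; ring
        _ ≤ ENNReal.ofReal (2 ^ |β| * (1 - ρ) ^ β) * 1 * B θ := by gcongr
        _ = _ := by rw [mul_one, ENNReal.ofReal_mul (by positivity)]
    · rw [Set.indicator_of_notMem (by rw [mem_ball_zero_iff, hn]; exact h1)]
      simp
  refine (setLIntegral_mono' polarCoord.open_target.measurableSet hle).trans_lt ?_
  rw [polarCoord_target, Measure.volume_eq_prod, ← Measure.prod_restrict,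
    lintegral_prod_mul hmA.aemeasurable hmB.aemeasurable]
  refine ENNReal.mul_lt_top ?_ (lintegral_enorm_sin_rpow_neg_lt_top hb0 hb)
  refine (setLIntegral_le_lintegral _ _).trans_lt ?_
  rw [hA, lintegral_indicator measurableSet_Ioo, lintegral_const_mul _ (by fun_prop)]
  exact ENNReal.mul_lt_top ENNReal.ofReal_lt_top (lintegral_one_sub_rpow_lt_top hβ)

theorem exists_rotation (z : ℂ) : ∃ e : ℂ ≃ₗᵢ[ℝ] ℂ, (e z).im = 0 := by
  refine ⟨rotation (Circle.exp (-z.arg)), ?_⟩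
  rw [rotation_apply, Circle.coe_exp]
  nth_rewrite 2 [← Complex.norm_mul_exp_arg_mul_I z]
  rw [mul_left_comm, ← Complex.exp_add]
  simp

/-- The Forelli–Rudin type estimate: away from the region `|z - w| ≪ 1 - |w| ^ 2` the kernel
`|z - w| ^ (-q)` has uniformly bounded weighted integrals when `q < α + 2`. -/
theorem exists_lintegral_kernel_le {α q M : ℝ} (hα : -1 < α) (hq0 : 0 < q) (hq : q < α + 2)
    (hM : 0 < M) : ∃ C : ℝ≥0, ∀ z : ℂ,
      ∫⁻ w in unitDisk, ENNReal.ofReal ((1 - ‖w‖ ^ 2) ^ α) *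
        (if 1 - ‖w‖ ^ 2 ≤ M * ‖z - w‖ then ENNReal.ofReal (‖z - w‖ ^ (-q)) else 0) ≤ C := by
  -- The exponent is split as `q = a + b`. The factor `|z - w|^(-a)` is traded for `(1 - |w|²)^(-a)`
  -- by the cutoff. After a rotation making `z` real, `|z - w|^(-b)` is bounded by `|Im w|^(-b)`,
  -- which no longer involves `z`. With this choice both integrability conditions, `b < 1` and `α -
  -- a > -1`, amount to `q < α + 2`.
  set b := q / (α + 2) with hb
  set a := b * (α + 1) with ha
  have hb0 : 0 < b := div_pos hq0 (by linarith)
  have hb1 : b < 1 := (div_lt_one (by linarith)).2 hq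
  have hab : a + b = q := by
    rw [ha, hb]; field_simp [show α + 2 ≠ 0 by linarith]; ring
  have ha0 : 0 < a := mul_pos hb0 (by linarith)
  have ha1 : -1 < α - a := by rw [ha]; nlinarith
  set F : ℂ → ℝ≥0∞ := unitDisk.indicator fun w =>
    ENNReal.ofReal ((1 - ‖w‖ ^ 2) ^ (α - a)) * ‖w.im‖ₑ ^ (-b) with hF
  have hFi : ∫⁻ w, F w < ⊤ := by
    rw [hF, lintegral_indicator measurableSet_unitDisk]
    exact lintegral_disk_mul_enorm_im_lt_top ha1 hb0.le hb1
  have hFm : Measurable F := Measurable.indicator (by fun_prop) measurableSet_ball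
  refine ⟨(ENNReal.ofReal (M ^ a) * ∫⁻ w, F w).toNNReal, fun z => ?_⟩
  rw [ENNReal.coe_toNNReal (ENNReal.mul_lt_top ENNReal.ofReal_lt_top hFi).ne]
  obtain ⟨e, he⟩ := exists_rotation z
  have hpt : ∀ w ∈ unitDisk, ENNReal.ofReal ((1 - ‖w‖ ^ 2) ^ α) *
      (if 1 - ‖w‖ ^ 2 ≤ M * ‖z - w‖ then ENNReal.ofReal (‖z - w‖ ^ (-q)) else 0) ≤
      ENNReal.ofReal (M ^ a) * F (e w) := by
    intro w hw
    have hw1 : ‖w‖ < 1 := by simpa [unitDisk] using hw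
    have hh : 0 < 1 - ‖w‖ ^ 2 := by nlinarith [norm_nonneg w]
    have hew : e w ∈ unitDisk := by simpa [unitDisk] using hw
    rw [hF, Set.indicator_of_mem hew, e.norm_map]
    split_ifs with hc
    swap
    · simp
    set h := 1 - ‖w‖ ^ 2 with hh'
    have hd : 0 < ‖z - w‖ := by
      rcases (norm_nonneg (z - w)).eq_or_lt with h0 | h0
      · rw [← h0] at hc; linarith
      · exact h0
    by_cases him : (e w).im = 0
    · rw [him, enorm_zero, ENNReal.zero_rpow_of_neg (by linarith), ENNReal.mul_top,
        ENNReal.mul_top]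
      · exact le_top
      · exact (ENNReal.ofReal_pos.2 (by positivity)).ne'
      · exact (ENNReal.ofReal_pos.2 (by positivity)).ne'
    have hi : 0 < ‖(e w).im‖ := norm_pos_iff.2 him
    have hid : ‖(e w).im‖ ≤ ‖z - w‖ := by
      have := Complex.abs_im_le_norm (e (z - w))
      rw [e.norm_map, map_sub, Complex.sub_im, he, zero_sub, abs_neg] at this
      exact this
    rw [← ofReal_norm, ENNReal.ofReal_rpow_of_pos hi, ← ENNReal.ofReal_mul (by positivity),
      ← ENNReal.ofReal_mul (by positivity), ← ENNReal.ofReal_mul (by positivity)]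
    refine ENNReal.ofReal_le_ofReal ?_
    have h1 : ‖z - w‖ ^ (-q) = ‖z - w‖ ^ (-a) * ‖z - w‖ ^ (-b) := by
      rw [← Real.rpow_add hd]; congr 1; linarith
    have h2 : ‖z - w‖ ^ (-a) ≤ (h / M) ^ (-a) :=
      Real.rpow_le_rpow_of_nonpos (by positivity) ((div_le_iff₀' hM).2 hc) (by linarith)
    have h3 : ‖z - w‖ ^ (-b) ≤ ‖(e w).im‖ ^ (-b) :=
      Real.rpow_le_rpow_of_nonpos hi hid (by linarith)
    have h4 : h ^ α * (h / M) ^ (-a) = M ^ a * h ^ (α - a) := by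
      rw [Real.div_rpow hh.le hM.le, Real.rpow_neg hM.le a, sub_eq_add_neg, Real.rpow_add hh]
      field_simp
    calc h ^ α * ‖z - w‖ ^ (-q) ≤ h ^ α * ((h / M) ^ (-a) * ‖(e w).im‖ ^ (-b)) := by
          rw [h1]; gcongr
      _ = _ := by rw [← mul_assoc, h4, mul_assoc]
  calc _ ≤ ∫⁻ w in unitDisk, ENNReal.ofReal (M ^ a) * F (e w) :=
        setLIntegral_mono' measurableSet_ball hpt
    _ ≤ ∫⁻ w, ENNReal.ofReal (M ^ a) * F (e w) := setLIntegral_le_lintegral _ _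
    _ = ENNReal.ofReal (M ^ a) * ∫⁻ w, F (e w) :=
        lintegral_const_mul _ (hFm.comp e.continuous.measurable)
    _ = _ := by rw [e.measurePreserving.lintegral_comp hFm]

/-! ### Geometry of the disk and weighted areas of small discs. -/

theorem one_sub_sq_pos {z : ℂ} (hz : z ∈ unitDisk) : 0 < 1 - ‖z‖ ^ 2 := by
  rw [mem_unitDisk] at hz
  nlinarith [norm_nonneg z]

theorem one_sub_sq_le_add {z w : ℂ} (hz : z ∈ unitDisk) (hw : w ∈ unitDisk) :
    1 - ‖w‖ ^ 2 ≤ 1 - ‖z‖ ^ 2 + 2 * ‖z - w‖ := by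
  rw [mem_unitDisk] at hz hw
  have := norm_sub_norm_le z w
  nlinarith [norm_nonneg z, norm_nonneg w, norm_nonneg (z - w)]

theorem ball_subset_unitDisk {z : ℂ} {s : ℝ} (hz : z ∈ unitDisk) (hs : s ≤ (1 - ‖z‖ ^ 2) / 2) :
    Metric.ball z s ⊆ unitDisk := by
  intro w hw
  rw [mem_unitDisk] at hz ⊢
  rw [mem_ball_iff_norm] at hw
  have := norm_sub_norm_le w z
  nlinarith [norm_nonneg z, norm_nonneg w, norm_nonneg (w - z)]

theorem rpow_le_two_rpow_abs_mul {x y : ℝ} (hx : 0 < x) (hy : 0 < y) (hxy : x ≤ 2 * y)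
    (hyx : y ≤ 2 * x) (a : ℝ) : x ^ a ≤ 2 ^ |a| * y ^ a := by
  rcases le_total 0 a with ha | ha
  · rw [abs_of_nonneg ha, ← Real.mul_rpow (by norm_num) hy.le]
    exact Real.rpow_le_rpow hx.le hxy ha
  · rw [abs_of_nonpos ha, Real.rpow_neg (by norm_num), ← Real.inv_rpow (by norm_num),
      ← Real.mul_rpow (by norm_num) hy.le]
    exact Real.rpow_le_rpow_of_nonpos (by positivity) (by linarith) ha

/-- No measurability of `g` is needed, because the density is measurable and finite. -/
theorem lintegral_weightedArea {α : ℝ} (hα : -1 < α) (g : ℂ → ℝ≥0∞) :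
    ∫⁻ z, g z ∂weightedArea α = ENNReal.ofReal ((α + 1) / Real.pi) *
      ∫⁻ z in unitDisk, ENNReal.ofReal ((1 - ‖z‖ ^ 2) ^ α) * g z := by
  rw [weightedArea, lintegral_withDensity_eq_lintegral_mul_non_measurable _ (by fun_prop)
    (ae_of_all _ fun _ => ENNReal.ofReal_lt_top), normalizedArea, lintegral_smul_measure,
    ← ENNReal.ofReal_inv_of_pos Real.pi_pos, smul_eq_mul]
  simp only [Pi.mul_apply, ENNReal.ofReal_mul (show 0 ≤ α + 1 by linarith), mul_assoc]
  rw [lintegral_const_mul' _ _ ENNReal.ofReal_ne_top, ← mul_assoc,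
    ← ENNReal.ofReal_mul (by positivity)]
  congr 2; ring

theorem weightedArea_absolutelyContinuous (α : ℝ) :
    weightedArea α ≪ volume.restrict unitDisk :=
  (withDensity_absolutelyContinuous _ _).trans Measure.smul_absolutelyContinuous

theorem ae_weightedArea_mem (α : ℝ) : ∀ᵐ z ∂weightedArea α, z ∈ unitDisk :=
  (weightedArea_absolutelyContinuous α).ae_le (self_mem_ae_restrict measurableSet_unitDisk)

theorem setLIntegral_weightedArea {α : ℝ} (hα : -1 < α) {s : Set ℂ} (hs : MeasurableSet s)
    (hsub : s ⊆ unitDisk) (g : ℂ → ℝ≥0∞) :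
    ∫⁻ z in s, g z ∂weightedArea α = ENNReal.ofReal ((α + 1) / Real.pi) *
      ∫⁻ z in s, ENNReal.ofReal ((1 - ‖z‖ ^ 2) ^ α) * g z := by
  rw [← lintegral_indicator hs, lintegral_weightedArea hα]
  congr 1
  rw [← lintegral_indicator measurableSet_unitDisk, ← lintegral_indicator hs]
  refine lintegral_congr fun z => ?_
  by_cases hz : z ∈ s
  · simp [hz, hsub hz]
  · by_cases hz' : z ∈ unitDisk <;> simp [hz, hz']

instance sFinite_weightedArea (α : ℝ) : SFinite (weightedArea α) := by
  unfold weightedArea normalizedArea; infer_instance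

theorem one_sub_sq_comparable {z w : ℂ} {s : ℝ} (hz : z ∈ unitDisk) (hs : s ≤ (1 - ‖z‖ ^ 2) / 4)
    (hw : w ∈ Metric.ball z s) : w ∈ unitDisk ∧ 1 - ‖w‖ ^ 2 ≤ 2 * (1 - ‖z‖ ^ 2) ∧
      1 - ‖z‖ ^ 2 ≤ 2 * (1 - ‖w‖ ^ 2) := by
  have hzp := one_sub_sq_pos hz
  have hwD : w ∈ unitDisk := ball_subset_unitDisk hz (by linarith) hw
  have h1 := one_sub_sq_le_add hz hwD
  have h2 := one_sub_sq_le_add hwD hz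
  rw [mem_ball_iff_norm] at hw
  rw [norm_sub_rev z w] at h1
  exact ⟨hwD, by linarith, by linarith⟩

theorem weightedArea_ball_le {α : ℝ} (hα : -1 < α) {z : ℂ} {s : ℝ} (hz : z ∈ unitDisk)
    (hs : s ≤ (1 - ‖z‖ ^ 2) / 4) : weightedArea α (Metric.ball z s) ≤
      ENNReal.ofReal ((α + 1) * 2 ^ |α| * (1 - ‖z‖ ^ 2) ^ α * s ^ 2) := by
  rcases le_or_gt s 0 with hs0 | hs0
  · rw [Metric.ball_eq_empty.2 hs0]; simp
  have hzp := one_sub_sq_pos hz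
  have hsub : Metric.ball z s ⊆ unitDisk := ball_subset_unitDisk hz (by linarith)
  rw [← setLIntegral_one, setLIntegral_weightedArea hα measurableSet_ball hsub]
  calc _ ≤ ENNReal.ofReal ((α + 1) / Real.pi) * ∫⁻ w in Metric.ball z s,
        ENNReal.ofReal (2 ^ |α| * (1 - ‖z‖ ^ 2) ^ α) := by
        gcongr 1
        refine setLIntegral_mono' measurableSet_ball fun w hw => ?_
        obtain ⟨hwD, h1, h2⟩ := one_sub_sq_comparable hz hs hw
        rw [mul_one]
        exact ENNReal.ofReal_le_ofReal
          (rpow_le_two_rpow_abs_mul (one_sub_sq_pos hwD) hzp h1 h2 α)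
    _ = _ := by
        have : 0 ≤ (1 - ‖z‖ ^ 2) ^ α := Real.rpow_nonneg hzp.le _
        have h1 : 0 ≤ (α + 1) / Real.pi := div_nonneg (by linarith) Real.pi_pos.le
        rw [setLIntegral_const, Complex.volume_ball, ← ENNReal.ofReal_coe_nnreal,
          ← ENNReal.ofReal_pow hs0.le, NNReal.coe_real_pi, ← ENNReal.ofReal_mul (by positivity),
          ← ENNReal.ofReal_mul (by positivity), ← ENNReal.ofReal_mul h1]
        congr 1
        field_simp

theorem le_weightedArea_ball {α : ℝ} (hα : -1 < α) {z : ℂ} {s : ℝ} (hz : z ∈ unitDisk)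
    (hs : s ≤ (1 - ‖z‖ ^ 2) / 4) (hs0 : 0 ≤ s) :
      ENNReal.ofReal ((α + 1) * (2 ^ |α|)⁻¹ * (1 - ‖z‖ ^ 2) ^ α * s ^ 2) ≤
        weightedArea α (Metric.ball z s) := by
  have hzp := one_sub_sq_pos hz
  have hsub : Metric.ball z s ⊆ unitDisk := ball_subset_unitDisk hz (by linarith)
  rw [← setLIntegral_one, setLIntegral_weightedArea hα measurableSet_ball hsub]
  calc _ = ENNReal.ofReal ((α + 1) / Real.pi) * ∫⁻ w in Metric.ball z s,
        ENNReal.ofReal ((2 ^ |α|)⁻¹ * (1 - ‖z‖ ^ 2) ^ α) := by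
        have : 0 ≤ (1 - ‖z‖ ^ 2) ^ α := Real.rpow_nonneg hzp.le _
        have h1 : 0 ≤ (α + 1) / Real.pi := div_nonneg (by linarith) Real.pi_pos.le
        rw [setLIntegral_const, Complex.volume_ball, ← ENNReal.ofReal_coe_nnreal,
          ← ENNReal.ofReal_pow hs0, NNReal.coe_real_pi, ← ENNReal.ofReal_mul (by positivity),
          ← ENNReal.ofReal_mul (by positivity), ← ENNReal.ofReal_mul h1]
        congr 1
        field_simp
    _ ≤ _ := by
        gcongr 1
        refine setLIntegral_mono' measurableSet_ball fun w hw => ?_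
        obtain ⟨hwD, h1, h2⟩ := one_sub_sq_comparable hz hs hw
        rw [mul_one]
        refine ENNReal.ofReal_le_ofReal ?_
        rw [inv_mul_le_iff₀ (by positivity)]
        exact rpow_le_two_rpow_abs_mul hzp (one_sub_sq_pos hwD) h2 h1 α

theorem aestronglyMeasurable_weightedArea {f : ℂ → ℂ} (hf : ContinuousOn f unitDisk) (α : ℝ) :
    AEStronglyMeasurable f (weightedArea α) :=
  (hf.aestronglyMeasurable measurableSet_unitDisk).mono_ac (weightedArea_absolutelyContinuous α)

theorem aestronglyMeasurable_weightedArea_prod {F : ℂ × ℂ → ℂ}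
    (hF : ContinuousOn F (unitDisk ×ˢ unitDisk)) (α : ℝ) :
    AEStronglyMeasurable F ((weightedArea α).prod (weightedArea α)) := by
  refine (hF.aestronglyMeasurable (μ := volume.prod volume)
    (measurableSet_unitDisk.prod measurableSet_unitDisk)).mono_ac ?_
  rw [← Measure.prod_restrict]
  exact (weightedArea_absolutelyContinuous α).prod (weightedArea_absolutelyContinuous α)

/-- The kernel estimate with respect to the weighted area measure. -/
theorem exists_lintegral_weightedArea_kernel_le {α q M : ℝ} (hα : -1 < α) (hq0 : 0 < q)
    (hq : q < α + 2) (hM : 0 < M) : ∃ C : ℝ≥0, ∀ z : ℂ,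
      ∫⁻ w, (if 1 - ‖w‖ ^ 2 ≤ M * ‖z - w‖ then ENNReal.ofReal (‖z - w‖ ^ (-q)) else 0)
        ∂weightedArea α ≤ C := by
  obtain ⟨C, hC⟩ := exists_lintegral_kernel_le hα hq0 hq hM
  refine ⟨((α + 1) / Real.pi).toNNReal * C, fun z => ?_⟩
  rw [lintegral_weightedArea hα, ENNReal.coe_mul]
  exact mul_le_mul' le_rfl (hC z)

/-! ### Holomorphy and local bounds of the lifting. -/

theorem symmetricLift_of_ne (f : ℂ → ℂ) {x : ℂ × ℂ} (h : x.1 ≠ x.2) :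
    symmetricLift f x = (f x.1 - f x.2) / (x.1 - x.2) := if_neg h

theorem symmetricLift_self (f : ℂ → ℂ) (z : ℂ) : symmetricLift f (z, z) = deriv f z := if_pos rfl

/-- Relation between the lifting of `f` and that of its divided difference at `a`. -/
theorem symmetricLift_eq_dslope {f : ℂ → ℂ} {a : ℂ} {x : ℂ × ℂ}
    (hf : DifferentiableAt ℂ (dslope f a) x.1) :
    symmetricLift f x = dslope f a x.1 + (x.2 - a) * symmetricLift (dslope f a) x := by
  have hk : ∀ z, f z = f a + (z - a) * dslope f a z := fun z => by
    have := sub_smul_dslope f a z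
    rw [smul_eq_mul] at this
    rw [this]; ring
  rcases eq_or_ne x.1 x.2 with h | h
  · obtain ⟨z, w⟩ := x
    obtain rfl : z = w := h
    rw [symmetricLift_self, symmetricLift_self]
    have : f = fun z => f a + (z - a) * dslope f a z := funext hk
    have hd := (((hasDerivAt_id z).sub_const a).mul hf.hasDerivAt).const_add (f a)
    conv_lhs => rw [this]
    rw [show deriv (fun z => f a + (z - a) * dslope f a z) z = _ from hd.deriv]
    simp
  · rw [symmetricLift_of_ne _ h, symmetricLift_of_ne _ h, hk x.1, hk x.2]
    field_simp [sub_ne_zero.2 h]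
    ring

theorem norm_symmetricLift_le {f : ℂ → ℂ} {z w : ℂ} {s : Set ℂ} {B : ℝ} (hs : Convex ℝ s)
    (hf : ∀ ξ ∈ s, DifferentiableAt ℂ f ξ) (hB : ∀ ξ ∈ s, ‖deriv f ξ‖ ≤ B) (hz : z ∈ s)
    (hw : w ∈ s) : ‖symmetricLift f (z, w)‖ ≤ B := by
  rcases eq_or_ne z w with rfl | h
  · rw [symmetricLift_self]; exact hB z hz
  · rw [symmetricLift_of_ne f (x := (z, w)) h, norm_div,
      div_le_iff₀ (norm_pos_iff.2 (sub_ne_zero.2 h))]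
    exact Convex.norm_image_sub_le_of_norm_deriv_le hf hB hs hw hz

/-- Only diagonal points need an argument. Two applications of `symmetricLift_eq_dslope` leave a
remainder `(w - a)²` times the lifting of `m`. That lifting is bounded near `(a, a)`, so the
remainder has derivative zero there. -/
theorem differentiableOn_symmetricLift {f : ℂ → ℂ} {s : Set ℂ} (hs : IsOpen s)
    (hf : DifferentiableOn ℂ f s) : DifferentiableOn ℂ (symmetricLift f) (s ×ˢ s) := by
  rintro ⟨a, b⟩ ⟨ha, hb⟩
  simp only at ha hb
  refine DifferentiableAt.differentiableWithinAt ?_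
  rcases eq_or_ne a b with rfl | hab
  · have hk : DifferentiableOn ℂ (dslope f a) s :=
      (Complex.differentiableOn_dslope (hs.mem_nhds ha)).2 hf
    have hm : DifferentiableOn ℂ (dslope (dslope f a) a) s :=
      (Complex.differentiableOn_dslope (hs.mem_nhds ha)).2 hk
    set k := dslope f a
    set m := dslope k a
    have hka : DifferentiableAt ℂ k a := hk.differentiableAt (hs.mem_nhds ha)
    have hma : DifferentiableAt ℂ m a := hm.differentiableAt (hs.mem_nhds ha)
    have hev : symmetricLift f =ᶠ[nhds (a, a)] fun x =>
        k x.1 + (x.2 - a) * m x.1 + (x.2 - a) ^ 2 * symmetricLift m x := by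
      have : ∀ᶠ x : ℂ × ℂ in nhds (a, a), x.1 ∈ s :=
        continuous_fst.continuousAt.preimage_mem_nhds (hs.mem_nhds ha)
      filter_upwards [this] with x hx
      rw [symmetricLift_eq_dslope (hk.differentiableAt (hs.mem_nhds hx)),
        symmetricLift_eq_dslope (f := dslope f a) (a := a) (hm.differentiableAt (hs.mem_nhds hx))]
      ring
    refine DifferentiableAt.congr_of_eventuallyEq ?_ hev
    refine DifferentiableAt.add ?_ ?_
    · exact (hka.comp (a, a) differentiableAt_fst).add
        ((differentiableAt_snd.sub_const a).mul (hma.comp (a, a) differentiableAt_fst))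
    -- the lifting of `m` is bounded near the diagonal point
    have hbdd : symmetricLift m =O[nhds (a, a)] fun _ => (1 : ℝ) := by
      have hc : ContinuousAt (deriv m) a :=
        ((hm.deriv hs).differentiableAt (hs.mem_nhds ha)).continuousAt
      have h1 : ∀ᶠ ξ in nhds a, ‖deriv m ξ‖ < ‖deriv m a‖ + 1 :=
        hc.norm.eventually_lt_const (lt_add_one _)
      obtain ⟨ε, hε, hball⟩ := Metric.eventually_nhds_iff_ball.1 (h1.and (hs.mem_nhds ha))
      refine Asymptotics.IsBigO.of_bound (‖deriv m a‖ + 1) ?_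
      filter_upwards [prod_mem_nhds (Metric.ball_mem_nhds a hε) (Metric.ball_mem_nhds a hε)]
        with x hx
      rw [norm_one, mul_one]
      exact norm_symmetricLift_le (convex_ball a ε)
        (fun ξ hξ => hm.differentiableAt (hs.mem_nhds (hball ξ hξ).2))
        (fun ξ hξ => (hball ξ hξ).1.le) hx.1 hx.2
    have h0 : HasFDerivAt (fun x : ℂ × ℂ => (x.2 - a) ^ 2 * symmetricLift m x)
        (0 : ℂ × ℂ →L[ℂ] ℂ) (a, a) := by
      rw [hasFDerivAt_iff_isLittleO]
      have h1 : (fun x : ℂ × ℂ => x.2 - a) =O[nhds (a, a)] fun x => x - (a, a) := by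
        refine Asymptotics.IsBigO.of_bound 1 (Filter.Eventually.of_forall fun x => ?_)
        rw [one_mul]; exact norm_snd_le (x - (a, a))
      have h2 : (fun x : ℂ × ℂ => x.2 - a) =o[nhds (a, a)] fun _ => (1 : ℝ) := by
        rw [Asymptotics.isLittleO_one_iff]
        have : Continuous fun x : ℂ × ℂ => x.2 - a := by fun_prop
        simpa using this.tendsto (a, a)
      have h3 := (h2.norm_norm.mul_isBigO (h1.norm_norm)).mul_isBigO hbdd.norm_norm
      simp only [sub_self, ne_eq, OfNat.ofNat_ne_zero, not_false_eq_true, zero_pow, zero_mul,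
        sub_zero, zero_apply]
      refine (Asymptotics.IsLittleO.of_norm_norm ?_)
      refine h3.congr (fun x => ?_) (fun x => ?_)
      · simp [pow_two]
      · simp
    exact h0.differentiableAt
  · have hev : symmetricLift f =ᶠ[nhds (a, b)] fun x => (f x.1 - f x.2) / (x.1 - x.2) := by
      have : ∀ᶠ x : ℂ × ℂ in nhds (a, b), x.1 ≠ x.2 :=
        (isOpen_ne_fun continuous_fst continuous_snd).mem_nhds hab
      filter_upwards [this] with x hx using symmetricLift_of_ne f hx
    refine DifferentiableAt.congr_of_eventuallyEq ?_ hev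
    have h1 : DifferentiableAt ℂ (fun x : ℂ × ℂ => f x.1) (a, b) :=
      (hf.differentiableAt (hs.mem_nhds ha)).comp (a, b) differentiableAt_fst
    have h2 : DifferentiableAt ℂ (fun x : ℂ × ℂ => f x.2) (a, b) :=
      (hf.differentiableAt (hs.mem_nhds hb)).comp (a, b) differentiableAt_snd
    have h3 : DifferentiableAt ℂ (fun x : ℂ × ℂ => x.1 - x.2) (a, b) := by fun_prop
    simp only [div_eq_mul_inv]
    exact (h1.sub h2).mul (h3.inv (sub_ne_zero.2 hab))

/-- The sub-mean value property on discs of radius `2s` bounds `|f|` by `N` on the disc of radius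
`2s` about `z`. Cauchy's estimate with radius `s` then gives `|f'| ≤ N / s` on the disc of radius
`s`, and the mean value inequality passes this bound to the divided difference. -/
theorem enorm_symmetricLift_rpow_le {f : ℂ → ℂ} {z w : ℂ} {s p : ℝ} (hp : 0 < p)
    (hf : DifferentiableOn ℂ f (Metric.ball z (4 * s))) (hw : w ∈ Metric.ball z s) :
    ‖symmetricLift f (z, w)‖ₑ ^ p ≤ ENNReal.ofReal (s ^ (-p) * (Real.pi * (2 * s) ^ 2)⁻¹) *
      ∫⁻ ζ in Metric.ball z (4 * s), ‖f ζ‖ₑ ^ p := by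
  have hs : 0 < s := dist_nonneg.trans_lt hw
  set I := ∫⁻ ζ in Metric.ball z (4 * s), ‖f ζ‖ₑ ^ p with hI
  by_cases hIt : I = ⊤
  · rw [hIt, ENNReal.mul_top]
    · exact le_top
    · exact (ENNReal.ofReal_pos.2 (by positivity)).ne'
  set N : ℝ := ((Real.pi * (2 * s) ^ 2)⁻¹ * I.toReal) ^ (1 / p) with hN
  have hval : ∀ ζ, dist ζ z < 2 * s → ‖f ζ‖ ≤ N := by
    intro ζ hζ
    have hsub : Metric.ball ζ (2 * s) ⊆ Metric.ball z (4 * s) :=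
      Metric.ball_subset_ball' (by linarith)
    have h := (enorm_rpow_le_lintegral_ball (by positivity) hp (hf.mono hsub)).trans
      (lintegral_mono_set hsub)
    rw [← hI, ← ofReal_norm, ENNReal.ofReal_rpow_of_nonneg (norm_nonneg _) hp.le,
      ← ENNReal.ofReal_mul (by positivity), ENNReal.ofReal_le_iff_le_toReal hIt] at h
    rw [hN, ← Real.rpow_le_rpow_iff (norm_nonneg _) (by positivity) hp,
      ← Real.rpow_mul (by positivity), one_div_mul_cancel hp.ne', Real.rpow_one]
    exact (le_inv_mul_iff₀ (by positivity)).2 h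
  have hder : ∀ ξ ∈ Metric.ball z s, ‖deriv f ξ‖ ≤ N / s := by
    intro ξ hξ
    have hξ' : dist ξ z < s := hξ
    refine Complex.norm_deriv_le_of_forall_mem_sphere_norm_le hs ?_ ?_
    · exact hf.diffContOnCl_ball (Metric.closedBall_subset_ball' (by linarith))
    · intro ζ hζ
      refine hval ζ ((dist_triangle ζ ξ z).trans_lt ?_)
      rw [Metric.mem_sphere.1 hζ]; linarith
  have hsub : Metric.ball z s ⊆ Metric.ball z (4 * s) := Metric.ball_subset_ball (by linarith)
  have h := norm_symmetricLift_le (convex_ball z s)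
    (fun ξ hξ => hf.differentiableAt (Metric.isOpen_ball.mem_nhds (hsub hξ))) hder
    (Metric.mem_ball_self hs) hw
  have hN0 : 0 ≤ N := by positivity
  have hNp : N ^ p = (Real.pi * (2 * s) ^ 2)⁻¹ * I.toReal := by
    rw [hN, ← Real.rpow_mul (by positivity), one_div_mul_cancel hp.ne', Real.rpow_one]
  calc ‖symmetricLift f (z, w)‖ₑ ^ p = ENNReal.ofReal (‖symmetricLift f (z, w)‖ ^ p) := by
        rw [← ofReal_norm, ENNReal.ofReal_rpow_of_nonneg (norm_nonneg _) hp.le]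
    _ ≤ ENNReal.ofReal ((N / s) ^ p) :=
        ENNReal.ofReal_le_ofReal (Real.rpow_le_rpow (norm_nonneg _) h hp.le)
    _ = ENNReal.ofReal (s ^ (-p) * (Real.pi * (2 * s) ^ 2)⁻¹ * I.toReal) := by
        rw [Real.div_rpow hN0 hs.le, hNp, Real.rpow_neg hs.le]; congr 1; ring
    _ = _ := by rw [ENNReal.ofReal_mul (by positivity), ENNReal.ofReal_toReal hIt]

/-! ### Boundedness for `p < α + 2`. -/

theorem enorm_rpow_eq_ofReal {E : Type*} [SeminormedAddCommGroup E] (x : E) {p : ℝ} (hp : 0 ≤ p) :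
    ‖x‖ₑ ^ p = ENNReal.ofReal (‖x‖ ^ p) := by
  rw [← ofReal_norm, ENNReal.ofReal_rpow_of_nonneg (norm_nonneg _) hp]

theorem ennreal_add_rpow_le (a b : ℝ≥0∞) {p : ℝ} (hp : 0 ≤ p) :
    (a + b) ^ p ≤ 2 ^ p * (a ^ p + b ^ p) := by
  rw [mul_add, ← ENNReal.mul_rpow_of_nonneg _ _ hp, ← ENNReal.mul_rpow_of_nonneg _ _ hp]
  rcases le_total a b with h | h
  · refine le_trans (ENNReal.rpow_le_rpow ?_ hp) le_add_self
    rw [two_mul]; gcongr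
  · refine le_trans (ENNReal.rpow_le_rpow ?_ hp) le_self_add
    rw [two_mul]; gcongr

/-- The kernel `|z - w| ^ (-q)` restricted to pairs that are separated in the hyperbolic sense. -/
noncomputable def separatedKernel (q M : ℝ) (z w : ℂ) : ℝ≥0∞ :=
  if 1 - ‖z‖ ^ 2 ≤ M * ‖z - w‖ ∧ 1 - ‖w‖ ^ 2 ≤ M * ‖z - w‖ then
    ENNReal.ofReal (‖z - w‖ ^ (-q)) else 0

theorem separatedKernel_comm (q M : ℝ) (z w : ℂ) :
    separatedKernel q M z w = separatedKernel q M w z := by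
  simp only [separatedKernel, norm_sub_rev z w, and_comm]

theorem measurable_separatedKernel (q M : ℝ) :
    Measurable fun x : ℂ × ℂ => separatedKernel q M x.1 x.2 := by
  unfold separatedKernel
  have h1 : MeasurableSet {x : ℂ × ℂ | 1 - ‖x.1‖ ^ 2 ≤ M * ‖x.1 - x.2‖} :=
    measurableSet_le (by fun_prop) (by fun_prop)
  have h2 : MeasurableSet {x : ℂ × ℂ | 1 - ‖x.2‖ ^ 2 ≤ M * ‖x.1 - x.2‖} :=
    measurableSet_le (by fun_prop) (by fun_prop)
  exact Measurable.ite (h1.inter h2) (by fun_prop) measurable_const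

theorem exists_lintegral_separatedKernel_le {α q M : ℝ} (hα : -1 < α) (hq0 : 0 < q)
    (hq : q < α + 2) (hM : 0 < M) : ∃ C : ℝ≥0, ∀ z : ℂ,
      ∫⁻ w, separatedKernel q M z w ∂weightedArea α ≤ C := by
  obtain ⟨C, hC⟩ := exists_lintegral_weightedArea_kernel_le hα hq0 hq hM
  refine ⟨C, fun z => (lintegral_mono fun w => ?_).trans (hC z)⟩
  unfold separatedKernel
  split_ifs with h1 h2 h2
  · exact le_rfl
  · exact absurd h1.2 h2
  · exact zero_le
  · exact le_rfl

/-- Having both cutoffs makes the kernel symmetric, so Tonelli turns the term with `G w` into the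
one with `G z`. -/
theorem lintegral_lintegral_separatedKernel_mul_le {μ : Measure ℂ} [SFinite μ] {q M : ℝ} {C : ℝ≥0∞}
    (hC : ∀ z : ℂ, ∫⁻ w, separatedKernel q M z w ∂μ ≤ C) {G : ℂ → ℝ≥0∞} (hG : Measurable G) :
    ∫⁻ z, ∫⁻ w, separatedKernel q M z w * (G z + G w) ∂μ ∂μ ≤ 2 * C * ∫⁻ z, G z ∂μ := by
  have hk := measurable_separatedKernel q M
  have hkz : ∀ z, Measurable fun w => separatedKernel q M z w := fun z =>
    Measurable.of_uncurry_left (f := separatedKernel q M) hk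
  have hm : Measurable fun x : ℂ × ℂ => separatedKernel q M x.1 x.2 * G x.1 :=
    hk.mul (hG.comp measurable_fst)
  have h1 : ∫⁻ z, ∫⁻ w, separatedKernel q M z w * G z ∂μ ∂μ ≤ C * ∫⁻ z, G z ∂μ := by
    rw [← lintegral_const_mul _ hG]
    refine lintegral_mono fun z => ?_
    rw [lintegral_mul_const _ (hkz z)]
    exact mul_le_mul' (hC z) le_rfl
  have h2 : ∫⁻ z, ∫⁻ w, separatedKernel q M z w * G w ∂μ ∂μ =
      ∫⁻ z, ∫⁻ w, separatedKernel q M z w * G z ∂μ ∂μ := by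
    rw [lintegral_lintegral_swap (f := fun z w => separatedKernel q M z w * G w)
      (hk.mul (hG.comp measurable_snd)).aemeasurable]
    refine lintegral_congr fun z => lintegral_congr fun w => ?_
    rw [separatedKernel_comm]
  calc _ = ∫⁻ z, (∫⁻ w, separatedKernel q M z w * G z ∂μ +
        ∫⁻ w, separatedKernel q M z w * G w ∂μ) ∂μ := by
        refine lintegral_congr fun z => ?_
        rw [← lintegral_add_left (f := fun w => separatedKernel q M z w * G z)
          ((hkz z).mul_const _)]
        simp only [mul_add]
    _ = ∫⁻ z, ∫⁻ w, separatedKernel q M z w * G z ∂μ ∂μ +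
        ∫⁻ z, ∫⁻ w, separatedKernel q M z w * G w ∂μ ∂μ :=
        lintegral_add_left (f := fun z => ∫⁻ w, separatedKernel q M z w * G z ∂μ)
          (Measurable.lintegral_prod_right' (f := fun x : ℂ × ℂ =>
            separatedKernel q M x.1 x.2 * G x.1) hm) _
    _ ≤ C * ∫⁻ z, G z ∂μ + C * ∫⁻ z, G z ∂μ := by rw [h2]; gcongr
    _ = _ := by ring

/-- After exchanging the integrals, `z` ranges over a disc about `ζ` of radius at most `(1 -
|ζ|²)/4`, whose weighted area is `≲ (1 - |ζ|²)^(α+2)`. Together with the weight this leaves `(1 -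
|ζ|²)^(α+2-p) ≤ 1`. -/
theorem lintegral_lintegral_ball_le {α p : ℝ} (hα : -1 < α) (hp : p ≤ α + 2) {G : ℂ → ℝ≥0∞}
    (hG : Measurable G) :
    ∫⁻ z, ∫⁻ ζ in Metric.ball z ((1 - ‖z‖ ^ 2) / 16), ENNReal.ofReal ((1 - ‖ζ‖ ^ 2) ^ (-p)) * G ζ
      ∂weightedArea α ∂weightedArea α ≤
    ENNReal.ofReal ((α + 1) * 2 ^ |α| / 16) * ∫⁻ ζ, G ζ ∂weightedArea α := by
  set μ := weightedArea α with hμ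
  set g : ℂ → ℝ≥0∞ := fun ζ => ENNReal.ofReal ((1 - ‖ζ‖ ^ 2) ^ (-p)) * G ζ with hg
  have hgm : Measurable g := by fun_prop
  set S : Set (ℂ × ℂ) := {x | dist x.2 x.1 < (1 - ‖x.1‖ ^ 2) / 16} with hS
  have hSm : MeasurableSet S := measurableSet_lt (by fun_prop) (by fun_prop)
  have h1 : ∀ z, ∫⁻ ζ in Metric.ball z ((1 - ‖z‖ ^ 2) / 16), g ζ ∂μ =
      ∫⁻ ζ, S.indicator (fun x => g x.2) (z, ζ) ∂μ := fun z => by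
    rw [← lintegral_indicator measurableSet_ball]
    rfl
  simp only [h1]
  rw [lintegral_lintegral_swap (f := fun z ζ => S.indicator (fun x => g x.2) (z, ζ)) ((hgm.comp measurable_snd).indicator hSm).aemeasurable,
    ← lintegral_const_mul _ hG]
  refine lintegral_mono_ae ?_
  filter_upwards [ae_weightedArea_mem α] with ζ hζ
  have hζp := one_sub_sq_pos hζ
  calc ∫⁻ z, S.indicator (fun x => g x.2) (z, ζ) ∂μ
      ≤ ∫⁻ z, (Metric.ball ζ ((1 - ‖ζ‖ ^ 2) / 4)).indicator (fun _ => g ζ) z ∂μ := by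
        refine lintegral_mono_ae ?_
        filter_upwards [ae_weightedArea_mem α] with z hz
        by_cases hzS : (z, ζ) ∈ S
        · have hd : dist ζ z < (1 - ‖z‖ ^ 2) / 16 := hzS
          have h2 := one_sub_sq_le_add hζ hz
          have hzb : z ∈ Metric.ball ζ ((1 - ‖ζ‖ ^ 2) / 4) := by
            rw [Metric.mem_ball, dist_comm]
            rw [← dist_eq_norm] at h2
            linarith
          rw [Set.indicator_of_mem hzS, Set.indicator_of_mem hzb]
        · rw [Set.indicator_of_notMem hzS]; exact zero_le
    _ = g ζ * μ (Metric.ball ζ ((1 - ‖ζ‖ ^ 2) / 4)) := lintegral_indicator_const measurableSet_ball _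
    _ ≤ g ζ * ENNReal.ofReal ((α + 1) * 2 ^ |α| * (1 - ‖ζ‖ ^ 2) ^ α * ((1 - ‖ζ‖ ^ 2) / 4) ^ 2) :=
        mul_le_mul' le_rfl (weightedArea_ball_le hα hζ le_rfl)
    _ ≤ _ := by
        rw [hg, mul_right_comm, ← ENNReal.ofReal_mul (by positivity)]
        refine mul_le_mul' (ENNReal.ofReal_le_ofReal ?_) le_rfl
        set h := 1 - ‖ζ‖ ^ 2
        have hle : h ^ (-p) * h ^ α * h ^ (2 : ℝ) ≤ 1 := by
          rw [← Real.rpow_add hζp, ← Real.rpow_add hζp]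
          refine Real.rpow_le_one hζp.le ?_ (by linarith)
          simp only [h]; nlinarith [sq_nonneg ‖ζ‖]
        rw [Real.rpow_two] at hle
        have hc : 0 ≤ (α + 1) * 2 ^ |α| / 16 := by
          have : 0 ≤ α + 1 := by linarith
          positivity
        calc _ = (α + 1) * 2 ^ |α| / 16 * (h ^ (-p) * h ^ α * h ^ 2) := by ring
          _ ≤ _ := mul_le_of_le_one_right hc hle

/-- The local bound is used with `s = (1 - |z|²)/64`, so that the larger disc of radius `4s` still
has `1 - |ζ|²` comparable to `1 - |z|²`. The factor `s^(-2)` cancels against the area of the small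
disc. -/
theorem setLIntegral_symmetricLift_ball_le {α p : ℝ} (hα : -1 < α) (hp : 0 < p) {f : ℂ → ℂ}
    (hf : DifferentiableOn ℂ f unitDisk) {z : ℂ} (hz : z ∈ unitDisk) :
    ∫⁻ w in Metric.ball z ((1 - ‖z‖ ^ 2) / 64), ‖symmetricLift f (z, w)‖ₑ ^ p ∂weightedArea α ≤
      ENNReal.ofReal (64 ^ p * 2 ^ |α| * 2 ^ |α - p| / 4) *
        ∫⁻ ζ in Metric.ball z ((1 - ‖z‖ ^ 2) / 16), ENNReal.ofReal ((1 - ‖ζ‖ ^ 2) ^ (-p)) *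
          unitDisk.indicator (fun ζ => ‖f ζ‖ₑ ^ p) ζ ∂weightedArea α := by
  have hzp := one_sub_sq_pos hz
  set h := 1 - ‖z‖ ^ 2 with hh
  set s := h / 64 with hs
  have hs0 : 0 < s := by positivity
  have h4 : h / 16 = 4 * s := by rw [hs]; ring
  have hsub : Metric.ball z (4 * s) ⊆ unitDisk := ball_subset_unitDisk hz (by rw [hs]; linarith)
  have hα1 : 0 < α + 1 := by linarith
  have hc : 0 < (α + 1) / Real.pi := by positivity
  rw [h4, setLIntegral_weightedArea hα measurableSet_ball hsub]
  set I := ∫⁻ ζ in Metric.ball z (4 * s), ‖f ζ‖ₑ ^ p with hI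
  calc ∫⁻ w in Metric.ball z s, ‖symmetricLift f (z, w)‖ₑ ^ p ∂weightedArea α
      ≤ ∫⁻ w in Metric.ball z s, ENNReal.ofReal (s ^ (-p) * (Real.pi * (2 * s) ^ 2)⁻¹) * I
          ∂weightedArea α :=
        setLIntegral_mono' measurableSet_ball fun w hw =>
          enorm_symmetricLift_rpow_le hp (hf.mono hsub) hw
    _ = ENNReal.ofReal (s ^ (-p) * (Real.pi * (2 * s) ^ 2)⁻¹) * I *
          weightedArea α (Metric.ball z s) := setLIntegral_const _ _
    _ ≤ ENNReal.ofReal (s ^ (-p) * (Real.pi * (2 * s) ^ 2)⁻¹) * I *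
          ENNReal.ofReal ((α + 1) * 2 ^ |α| * h ^ α * s ^ 2) :=
        mul_le_mul' le_rfl (weightedArea_ball_le hα hz (by rw [hs]; linarith))
    _ = ENNReal.ofReal (64 ^ p * 2 ^ |α| / 4 * ((α + 1) / Real.pi) * h ^ (α - p)) * I := by
        rw [mul_right_comm, ← ENNReal.ofReal_mul (by positivity)]
        congr 2
        rw [hs, Real.div_rpow hzp.le (by norm_num), Real.rpow_neg (by norm_num : (0:ℝ) ≤ 64),
          sub_eq_add_neg, Real.rpow_add hzp]
        field_simp
        ring
    _ ≤ ENNReal.ofReal (64 ^ p * 2 ^ |α| / 4 * ((α + 1) / Real.pi)) *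
          ∫⁻ ζ in Metric.ball z (4 * s), ENNReal.ofReal (2 ^ |α - p|) *
            (ENNReal.ofReal ((1 - ‖ζ‖ ^ 2) ^ α) * (ENNReal.ofReal ((1 - ‖ζ‖ ^ 2) ^ (-p)) *
              unitDisk.indicator (fun ζ => ‖f ζ‖ₑ ^ p) ζ)) := by
        rw [ENNReal.ofReal_mul (by positivity), mul_assoc,
          ← lintegral_const_mul' _ _ ENNReal.ofReal_ne_top]
        refine mul_le_mul' le_rfl (setLIntegral_mono' measurableSet_ball fun ζ hζ => ?_)
        obtain ⟨hζD, h1, h2⟩ := one_sub_sq_comparable hz (by rw [hs]; linarith) hζ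
        have hζp := one_sub_sq_pos hζD
        rw [Set.indicator_of_mem hζD, ← mul_assoc, ← mul_assoc,
          ← ENNReal.ofReal_mul (by positivity), ← ENNReal.ofReal_mul (by positivity)]
        refine mul_le_mul' (ENNReal.ofReal_le_ofReal ?_) le_rfl
        rw [mul_assoc, ← Real.rpow_add hζp, ← sub_eq_add_neg]
        exact rpow_le_two_rpow_abs_mul hzp hζp h2 h1 _
    _ = _ := by
        rw [lintegral_const_mul' _ _ ENNReal.ofReal_ne_top, ← mul_assoc, ← mul_assoc,
          ← ENNReal.ofReal_mul (by positivity), ← ENNReal.ofReal_mul (by positivity)]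
        congr 2
        ring

theorem enorm_symmetricLift_rpow_le_separatedKernel {p : ℝ} (hp : 0 < p) (f : ℂ → ℂ) {z w : ℂ}
    (hz : z ∈ unitDisk) (hw : w ∈ unitDisk) (hzw : (1 - ‖z‖ ^ 2) / 64 ≤ ‖z - w‖) :
    ‖symmetricLift f (z, w)‖ₑ ^ p ≤
      2 ^ p * (separatedKernel p 66 z w * (‖f z‖ₑ ^ p + ‖f w‖ₑ ^ p)) := by
  have hzp := one_sub_sq_pos hz
  have h1 := one_sub_sq_le_add hz hw
  have hd : 0 < ‖z - w‖ := lt_of_lt_of_le (by positivity) hzw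
  have hne : z ≠ w := fun h => by simp [h] at hd
  -- The constant is `66 = 64 + 2`: `1 - |w|² ≤ (1 - |z|²) + 2|z - w| ≤ 66 |z - w|`.
  rw [separatedKernel, if_pos ⟨by linarith, by linarith⟩, symmetricLift_of_ne f (x := (z, w)) hne,
    div_eq_mul_inv, enorm_mul, ENNReal.mul_rpow_of_nonneg _ _ hp.le,
    enorm_rpow_eq_ofReal (z - w)⁻¹ hp.le, norm_inv, Real.inv_rpow hd.le, ← Real.rpow_neg hd.le,
    mul_left_comm, mul_comm]
  refine mul_le_mul' le_rfl (le_trans (ENNReal.rpow_le_rpow ?_ hp.le) (ennreal_add_rpow_le _ _ hp.le))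
  exact enorm_sub_le

theorem exists_lintegral_symmetricLift_le {α p : ℝ} (hα : -1 < α) (hp : 0 < p) (hpα : p < α + 2) :
    ∃ C : ℝ≥0, ∀ f : ℂ → ℂ, DifferentiableOn ℂ f unitDisk →
      ∫⁻ z, ∫⁻ w, ‖symmetricLift f (z, w)‖ₑ ^ p ∂weightedArea α ∂weightedArea α ≤
        C * ∫⁻ z, ‖f z‖ₑ ^ p ∂weightedArea α := by
  obtain ⟨C, hC⟩ := exists_lintegral_separatedKernel_le (M := 66) hα hp hpα (by norm_num)
  set c₁ : ℝ := 64 ^ p * 2 ^ |α| * 2 ^ |α - p| / 4 with hc₁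
  set c₂ : ℝ := (α + 1) * 2 ^ |α| / 16 with hc₂
  refine ⟨c₁.toNNReal * c₂.toNNReal + 2 ^ p * (2 * C), fun f hf => ?_⟩
  set G : ℂ → ℝ≥0∞ := unitDisk.indicator (fun ζ => ‖f ζ‖ₑ ^ p) with hG
  have hGm : Measurable G :=
    measurable_indicator_enorm_rpow measurableSet_unitDisk hf.continuousOn p
  set μ := weightedArea α with hμ
  have hGi : ∫⁻ z, ‖f z‖ₑ ^ p ∂μ = ∫⁻ z, G z ∂μ := by
    refine lintegral_congr_ae ?_
    filter_upwards [ae_weightedArea_mem α] with z hz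
    rw [hG, Set.indicator_of_mem hz]
  have h2p : (2 : ℝ≥0∞) ^ p ≠ ⊤ := ENNReal.rpow_ne_top_of_nonneg hp.le (by norm_num)
  set Q : ℂ → ℝ≥0∞ := fun z => ∫⁻ w, separatedKernel p 66 z w * (G z + G w) ∂μ with hQ
  have hQm : Measurable Q := by
    refine Measurable.lintegral_prod_right' (f := fun x : ℂ × ℂ =>
      separatedKernel p 66 x.1 x.2 * (G x.1 + G x.2)) ?_
    exact (measurable_separatedKernel p 66).mul
      ((hGm.comp measurable_fst).add (hGm.comp measurable_snd))
  set R : ℂ → ℝ≥0∞ := fun z => ∫⁻ ζ in Metric.ball z ((1 - ‖z‖ ^ 2) / 16),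
    ENNReal.ofReal ((1 - ‖ζ‖ ^ 2) ^ (-p)) * G ζ ∂μ with hR
  have hinner : ∀ z ∈ unitDisk, ∫⁻ w, ‖symmetricLift f (z, w)‖ₑ ^ p ∂μ ≤
      2 ^ p * Q z + ENNReal.ofReal c₁ * R z := by
    intro z hz
    -- Near-diagonal disc against its complement: the former gives the term with `R`, the latter the
    -- term with `Q`.
    rw [← lintegral_add_compl _ (measurableSet_ball (x := z) (ε := (1 - ‖z‖ ^ 2) / 64)), add_comm]
    refine add_le_add ?_ (setLIntegral_symmetricLift_ball_le hα hp hf hz)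
    rw [hQ, ← lintegral_const_mul' _ _ h2p, ← lintegral_indicator measurableSet_ball.compl]
    refine lintegral_mono_ae ?_
    filter_upwards [ae_weightedArea_mem α] with w hw
    by_cases hwb : w ∈ (Metric.ball z ((1 - ‖z‖ ^ 2) / 64))ᶜ
    · rw [Set.indicator_of_mem hwb, hG, Set.indicator_of_mem hz, Set.indicator_of_mem hw]
      refine enorm_symmetricLift_rpow_le_separatedKernel hp f hz hw ?_
      rwa [Set.mem_compl_iff, mem_ball_iff_norm, not_lt, norm_sub_rev] at hwb
    · rw [Set.indicator_of_notMem hwb]; exact zero_le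
  calc ∫⁻ z, ∫⁻ w, ‖symmetricLift f (z, w)‖ₑ ^ p ∂μ ∂μ
      ≤ ∫⁻ z, (2 ^ p * Q z + ENNReal.ofReal c₁ * R z) ∂μ := by
        refine lintegral_mono_ae ?_
        filter_upwards [ae_weightedArea_mem α] with z hz using hinner z hz
    _ = 2 ^ p * ∫⁻ z, Q z ∂μ + ENNReal.ofReal c₁ * ∫⁻ z, R z ∂μ := by
        rw [lintegral_add_left (by fun_prop), lintegral_const_mul' _ _ h2p,
          lintegral_const_mul' _ _ ENNReal.ofReal_ne_top]
    _ ≤ 2 ^ p * (2 * C * ∫⁻ z, G z ∂μ) + ENNReal.ofReal c₁ * (ENNReal.ofReal c₂ * ∫⁻ z, G z ∂μ) := by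
        gcongr
        · exact lintegral_lintegral_separatedKernel_mul_le hC hGm
        · exact lintegral_lintegral_ball_le hα hpα.le hGm
    _ = _ := by
        rw [hGi, ENNReal.coe_add, ENNReal.coe_mul, ENNReal.coe_mul, ENNReal.coe_mul,
          ENNReal.coe_rpow_of_nonneg _ hp.le]
        simp only [ENNReal.ofReal, ENNReal.coe_ofNat]
        ring

theorem exists_symmetricLift_bounded {α p : ℝ} (hα : -1 < α) (hp : 0 < p) (hpα : p < α + 2) :
    ∃ C : ℝ≥0, ∀ f ∈ bergmanDisk p α, symmetricLift f ∈ bergmanBidisk p α ∧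
      bergmanBidiskNorm p α (symmetricLift f) ≤ C * bergmanDiskNorm p α f := by
  obtain ⟨C, hC⟩ := exists_lintegral_symmetricLift_le hα hp hpα
  refine ⟨C ^ (1 / p), fun f hf => ?_⟩
  have hp0 : ENNReal.ofReal p ≠ 0 := (ENNReal.ofReal_pos.2 hp).ne'
  have hd := differentiableOn_symmetricLift isOpen_unitDisk hf.1
  have hnorm : bergmanBidiskNorm p α (symmetricLift f) ≤
      (C ^ (1 / p) : ℝ≥0) * bergmanDiskNorm p α f := by
    rw [bergmanBidiskNorm, bergmanDiskNorm,
      eLpNorm_eq_lintegral_rpow_enorm_toReal hp0 ENNReal.ofReal_ne_top,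
      eLpNorm_eq_lintegral_rpow_enorm_toReal hp0 ENNReal.ofReal_ne_top,
      ENNReal.toReal_ofReal hp.le, ENNReal.coe_rpow_of_nonneg _ (by positivity),
      ← ENNReal.mul_rpow_of_nonneg _ _ (by positivity)]
    -- Only the bound of the product integral by the iterated one is used, and it needs no
    -- measurability.
    exact ENNReal.rpow_le_rpow ((lintegral_prod_le _).trans (hC f hf.1)) (by positivity)
  refine ⟨⟨hd, aestronglyMeasurable_weightedArea_prod hd.continuousOn α, ?_⟩, hnorm⟩
  exact hnorm.trans_lt (ENNReal.mul_lt_top ENNReal.coe_lt_top hf.2.2)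

/-! ### Failure for `p > α + 2`. -/

theorem one_sub_mem_slitPlane {z : ℂ} (hz : z ∈ unitDisk) : 1 - z ∈ Complex.slitPlane := by
  rw [mem_unitDisk] at hz
  left
  have := (Complex.abs_re_le_norm z).trans_lt hz
  rw [Complex.sub_re, Complex.one_re]
  linarith [(abs_lt.1 this).2]

theorem differentiableOn_one_sub_cpow (s : ℂ) :
    DifferentiableOn ℂ (fun z => (1 - z) ^ s) unitDisk := fun _ hz =>
  (((differentiableAt_const 1).sub differentiableAt_id).cpow_const
    (one_sub_mem_slitPlane hz)).differentiableWithinAt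

/-- This is the kernel estimate at the boundary point `z = 1` with exponent `cp`. With `M = 2` the
cutoff holds on the whole disk, since `1 - |w|² ≤ 2(1 - |w|) ≤ 2|1 - w|`. -/
theorem one_sub_cpow_mem_bergmanDisk {α p c : ℝ} (hα : -1 < α) (hp : 0 < p) (hc : 0 < c)
    (hcp : c * p < α + 2) : (fun z : ℂ => (1 - z) ^ ((-c : ℝ) : ℂ)) ∈ bergmanDisk p α := by
  have hd := differentiableOn_one_sub_cpow ((-c : ℝ) : ℂ)
  refine ⟨hd, aestronglyMeasurable_weightedArea hd.continuousOn α, ?_⟩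
  rw [eLpNorm_lt_top_iff_lintegral_rpow_enorm_lt_top (ENNReal.ofReal_pos.2 hp).ne'
    ENNReal.ofReal_ne_top, ENNReal.toReal_ofReal hp.le]
  obtain ⟨C, hC⟩ := exists_lintegral_weightedArea_kernel_le (M := 2) hα (mul_pos hc hp) hcp
    (by norm_num)
  refine lt_of_le_of_lt (lintegral_mono_ae ?_) ((hC 1).trans_lt ENNReal.coe_lt_top)
  filter_upwards [ae_weightedArea_mem α] with w hw
  rw [mem_unitDisk] at hw
  have h1 : 1 - ‖w‖ ≤ ‖1 - w‖ := by simpa using norm_sub_norm_le (1 : ℂ) w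
  rw [if_pos (by nlinarith [norm_nonneg w]), enorm_rpow_eq_ofReal _ hp.le, Complex.norm_cpow_real,
    ← Real.rpow_mul (norm_nonneg _), neg_mul]

theorem exists_weightedArea_ball_one_sub {α : ℝ} (hα : -1 < α) : ∃ c₀ c₁ : ℝ, 0 < c₀ ∧
    ∀ t : ℝ, 0 < t → t ≤ 1 →
      ENNReal.ofReal (c₀ * t ^ (α + 2)) ≤
        weightedArea α (Metric.ball (1 - t : ℂ) (t / 4)) ∧
      weightedArea α (Metric.ball (1 - t : ℂ) (t / 4)) ≤ ENNReal.ofReal (c₁ * t ^ (α + 2)) := by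
  have hα1 : 0 < α + 1 := by linarith
  refine ⟨(α + 1) * (2 ^ |α|)⁻¹ * (2 ^ |α|)⁻¹ / 16, (α + 1) * 2 ^ |α| * 2 ^ |α| / 16,
    by positivity, fun t ht ht1 => ?_⟩
  have hn : ‖(1 - t : ℂ)‖ = 1 - t := by
    rw [← Complex.ofReal_one, ← Complex.ofReal_sub, Complex.norm_real,
      Real.norm_of_nonneg (by linarith)]
  have hD : (1 - t : ℂ) ∈ unitDisk := by rw [mem_unitDisk, hn]; linarith
  have h1 : t ≤ 1 - ‖(1 - t : ℂ)‖ ^ 2 := by rw [hn]; nlinarith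
  have h2 : 1 - ‖(1 - t : ℂ)‖ ^ 2 ≤ 2 * t := by rw [hn]; nlinarith
  have hpos := one_sub_sq_pos hD
  have ht2 : t ^ (α + 2) = t ^ α * t ^ 2 := by rw [Real.rpow_add ht, Real.rpow_two]
  constructor
  · refine le_trans (ENNReal.ofReal_le_ofReal ?_)
      (le_weightedArea_ball hα hD (by linarith) (by positivity))
    have h3 : (2 ^ |α|)⁻¹ * t ^ α ≤ (1 - ‖(1 - t : ℂ)‖ ^ 2) ^ α := by
      rw [inv_mul_le_iff₀ (by positivity)]
      exact rpow_le_two_rpow_abs_mul ht hpos (by linarith) h2 α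
    calc _ = (α + 1) * (2 ^ |α|)⁻¹ * ((2 ^ |α|)⁻¹ * t ^ α) * (t / 4) ^ 2 := by rw [ht2]; ring
      _ ≤ _ := by gcongr
  · refine (weightedArea_ball_le hα hD (by linarith)).trans (ENNReal.ofReal_le_ofReal ?_)
    have h3 := rpow_le_two_rpow_abs_mul hpos ht h2 (by linarith) α
    calc _ ≤ (α + 1) * 2 ^ |α| * (2 ^ |α| * t ^ α) * (t / 4) ^ 2 := by gcongr
      _ = _ := by rw [ht2]; ring

/-- The two discs are far enough apart for the values of `f` not to cancel: `|1 - z| ≤ 5t/4` while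
`|1 - w| ≥ 3t`. The second disc is the first with `4t` in place of `t`, so the same area estimate
serves both. -/
theorem exists_norm_symmetricLift_one_sub_cpow_ge {c : ℝ} (hc : 0 < c) : ∃ κ : ℝ, 0 < κ ∧
    ∀ t : ℝ, 0 < t → ∀ z ∈ Metric.ball (1 - t : ℂ) (t / 4),
      ∀ w ∈ Metric.ball (1 - (4 * t : ℝ) : ℂ) (4 * t / 4),
        κ * t ^ (-c - 1) ≤
          ‖symmetricLift (fun z : ℂ => (1 - z) ^ ((-c : ℝ) : ℂ)) (z, w)‖ := by
  have hlt : (3 : ℝ) ^ (-c) < (5 / 4) ^ (-c) :=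
    Real.rpow_lt_rpow_of_neg (by norm_num) (by norm_num) (by linarith)
  refine ⟨((5 / 4) ^ (-c) - 3 ^ (-c)) / 9, by linarith, fun t ht z hz w hw => ?_⟩
  rw [mem_ball_iff_norm] at hz hw
  have htn : ‖(t : ℂ)‖ = t := by rw [Complex.norm_real, Real.norm_of_nonneg ht.le]
  have h4tn : ‖((4 * t : ℝ) : ℂ)‖ = 4 * t := by
    rw [Complex.norm_real, Real.norm_of_nonneg (by positivity)]
  have h1 : 3 / 4 * t ≤ ‖1 - z‖ := by
    have := norm_sub_norm_le (t : ℂ) (z - (1 - t))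
    rw [show (t : ℂ) - (z - (1 - t)) = 1 - z by ring] at this
    linarith
  have h2 : ‖1 - z‖ ≤ 5 / 4 * t := by
    have := norm_sub_le (t : ℂ) (z - (1 - t))
    rw [show (t : ℂ) - (z - (1 - t)) = 1 - z by ring] at this
    linarith
  have h3 : 3 * t ≤ ‖1 - w‖ := by
    have := norm_sub_norm_le ((4 * t : ℝ) : ℂ) (w - (1 - (4 * t : ℝ)))
    rw [show ((4 * t : ℝ) : ℂ) - (w - (1 - (4 * t : ℝ))) = 1 - w by ring] at this
    linarith
  have h4 : ‖1 - w‖ ≤ 5 * t := by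
    have := norm_sub_le ((4 * t : ℝ) : ℂ) (w - (1 - (4 * t : ℝ)))
    rw [show ((4 * t : ℝ) : ℂ) - (w - (1 - (4 * t : ℝ))) = 1 - w by ring] at this
    linarith
  have hne : z ≠ w := fun h => by rw [h] at h2; linarith
  have hd : ‖z - w‖ ≤ 9 * t := by
    have := norm_sub_le (1 - w) (1 - z)
    rw [show (1 - w) - (1 - z) = z - w by ring] at this
    linarith
  rw [symmetricLift_of_ne _ (x := (z, w)) hne, norm_div]
  have hdp : 0 < ‖z - w‖ := norm_pos_iff.2 (sub_ne_zero.2 hne)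
  have hfz : (5 / 4) ^ (-c) * t ^ (-c) ≤ ‖(1 - z) ^ ((-c : ℝ) : ℂ)‖ := by
    rw [Complex.norm_cpow_real, ← Real.mul_rpow (by norm_num) ht.le]
    exact Real.rpow_le_rpow_of_nonpos (by linarith) h2 (by linarith)
  have hfw : ‖(1 - w) ^ ((-c : ℝ) : ℂ)‖ ≤ 3 ^ (-c) * t ^ (-c) := by
    rw [Complex.norm_cpow_real, ← Real.mul_rpow (by norm_num) ht.le]
    exact Real.rpow_le_rpow_of_nonpos (by linarith) h3 (by linarith)
  have hnum := norm_sub_norm_le ((1 - z) ^ ((-c : ℝ) : ℂ)) ((1 - w) ^ ((-c : ℝ) : ℂ))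
  rw [le_div_iff₀ hdp]
  have hk : 0 ≤ ((5 / 4) ^ (-c) - 3 ^ (-c)) / 9 * t ^ (-c - 1) :=
    mul_nonneg (by linarith) (Real.rpow_nonneg ht.le _)
  calc _ ≤ ((5 / 4) ^ (-c) - 3 ^ (-c)) / 9 * t ^ (-c - 1) * (9 * t) :=
        mul_le_mul_of_nonneg_left hd hk
    _ = (5 / 4) ^ (-c) * t ^ (-c) - 3 ^ (-c) * t ^ (-c) := by
        rw [Real.rpow_sub_one ht.ne']; field_simp
    _ ≤ _ := by linarith

/-- If `|Lf|^p` were integrable, its integral over `S t` would tend to `0` with the measure of `S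
t`. But that integral is at least a constant times `t^(2(α+2) - (c+1)p)`, whose exponent is
nonpositive. -/
theorem symmetricLift_one_sub_cpow_notMem_bergmanBidisk {α p c : ℝ} (hα : -1 < α) (hp : 0 < p)
    (hc : 0 < c) (hcp : 2 * (α + 2) ≤ (c + 1) * p) :
    symmetricLift (fun z : ℂ => (1 - z) ^ ((-c : ℝ) : ℂ)) ∉ bergmanBidisk p α := by
  intro hmem
  obtain ⟨κ, hκ, hlow⟩ := exists_norm_symmetricLift_one_sub_cpow_ge hc
  obtain ⟨c₀, c₁, hc₀, hμ⟩ := exists_weightedArea_ball_one_sub hα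
  set L := symmetricLift (fun z : ℂ => (1 - z) ^ ((-c : ℝ) : ℂ)) with hL
  set μ := weightedArea α
  have hfin := hmem.2.2
  rw [eLpNorm_lt_top_iff_lintegral_rpow_enorm_lt_top (ENNReal.ofReal_pos.2 hp).ne'
    ENNReal.ofReal_ne_top, ENNReal.toReal_ofReal hp.le] at hfin
  set S : ℝ → Set (ℂ × ℂ) := fun t =>
    Metric.ball (1 - t : ℂ) (t / 4) ×ˢ Metric.ball (1 - (4 * t : ℝ) : ℂ) (4 * t / 4) with hS
  have hev : ∀ᶠ t : ℝ in nhdsWithin 0 (Set.Ioi 0), 0 < t ∧ 4 * t ≤ 1 := by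
    filter_upwards [Ioo_mem_nhdsGT (show (0 : ℝ) < 1 / 4 by norm_num)] with t ht
    exact ⟨ht.1, by linarith [ht.2]⟩
  have hα2 : 0 < α + 2 := by linarith
  have hmeas : Filter.Tendsto ((μ.prod μ) ∘ S) (nhdsWithin 0 (Set.Ioi 0)) (nhds 0) := by
    have hz : Filter.Tendsto (fun t : ℝ => ENNReal.ofReal (c₁ * t ^ (α + 2)) *
        ENNReal.ofReal (c₁ * (4 * t) ^ (α + 2))) (nhdsWithin 0 (Set.Ioi 0)) (nhds 0) := by
      have h1 : Continuous fun t : ℝ => ENNReal.ofReal (c₁ * t ^ (α + 2)) :=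
        ENNReal.continuous_ofReal.comp
          (continuous_const.mul (continuous_id.rpow_const fun _ => Or.inr hα2.le))
      have h2 : Continuous fun t : ℝ => ENNReal.ofReal (c₁ * (4 * t) ^ (α + 2)) :=
        h1.comp (continuous_const.mul continuous_id)
      have h3 := ENNReal.Tendsto.mul (h1.tendsto 0) (Or.inr (by simp))
        (h2.tendsto 0) (Or.inr (by simp))
      simp only [mul_zero, Real.zero_rpow hα2.ne', ENNReal.ofReal_zero] at h3
      exact h3.mono_left nhdsWithin_le_nhds
    refine tendsto_of_tendsto_of_tendsto_of_le_of_le' tendsto_const_nhds hz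
      (Filter.Eventually.of_forall fun _ => zero_le) ?_
    filter_upwards [hev] with t ht
    rw [Function.comp_apply, hS, Measure.prod_prod]
    exact mul_le_mul' (hμ t ht.1 (by linarith)).2 (hμ (4 * t) (by linarith) ht.2).2
  have hlim := tendsto_setLIntegral_zero hfin.ne hmeas
  set δ : ℝ≥0∞ := ENNReal.ofReal (κ ^ p * c₀ ^ 2 * 4 ^ (α + 2)) with hδ
  have hδ0 : 0 < δ := ENNReal.ofReal_pos.2 (by positivity)
  obtain ⟨t, ⟨ht0, ht1⟩, ht⟩ := (hev.and (hlim.eventually_lt_const hδ0)).exists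
  refine absurd ht (not_lt.2 ?_)
  have hSm : MeasurableSet (S t) := measurableSet_ball.prod measurableSet_ball
  calc δ ≤ ENNReal.ofReal ((κ * t ^ (-c - 1)) ^ p) *
        (ENNReal.ofReal (c₀ * t ^ (α + 2)) * ENNReal.ofReal (c₀ * (4 * t) ^ (α + 2))) := by
        rw [← ENNReal.ofReal_mul (by positivity), ← ENNReal.ofReal_mul (by positivity)]
        refine ENNReal.ofReal_le_ofReal ?_
        have h1 : 1 ≤ t ^ (((-c - 1) * p) + (α + 2) + (α + 2)) :=
          Real.one_le_rpow_of_pos_of_le_one_of_nonpos ht0 (by linarith) (by linarith)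
        rw [Real.rpow_add ht0, Real.rpow_add ht0, Real.rpow_mul ht0.le] at h1
        rw [Real.mul_rpow hκ.le (Real.rpow_nonneg ht0.le _),
          Real.mul_rpow (by norm_num : (0 : ℝ) ≤ 4) ht0.le]
        have h2 : 0 ≤ κ ^ p * c₀ ^ 2 * 4 ^ (α + 2) := by positivity
        calc _ ≤ κ ^ p * c₀ ^ 2 * 4 ^ (α + 2) *
              ((t ^ (-c - 1)) ^ p * t ^ (α + 2) * t ^ (α + 2)) := le_mul_of_one_le_right h2 h1
          _ = _ := by ring
    _ ≤ ENNReal.ofReal ((κ * t ^ (-c - 1)) ^ p) * (μ.prod μ) (S t) := by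
        rw [hS, Measure.prod_prod]
        exact mul_le_mul' le_rfl
          (mul_le_mul' (hμ t ht0 (by linarith)).1 (hμ (4 * t) (by linarith) ht1).1)
    _ = ∫⁻ _ in S t, ENNReal.ofReal ((κ * t ^ (-c - 1)) ^ p) ∂(μ.prod μ) :=
        (setLIntegral_const _ _).symm
    _ ≤ ∫⁻ x in S t, ‖L x‖ₑ ^ p ∂(μ.prod μ) := by
        refine setLIntegral_mono' hSm fun x hx => ?_
        rw [enorm_rpow_eq_ofReal _ hp.le]
        refine ENNReal.ofReal_le_ofReal (Real.rpow_le_rpow (by positivity) ?_ hp.le)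
        exact hlow t ht0 x.1 hx.1 x.2 hx.2

theorem exists_symmetricLift_notMem {α p : ℝ} (hα : -1 < α) (hp : 0 < p) (hpα : α + 2 < p) :
    ∃ f ∈ bergmanDisk p α, symmetricLift f ∉ bergmanBidisk p α := by
  -- With `c = (α + 2 - ε)/p`, positivity of `ε` gives `cp < α + 2`. The bound `ε ≤ p - (α + 2)`
  -- gives `(c + 1)p ≥ 2(α + 2)`, and `ε ≤ (α + 2)/2` keeps `c > 0`.
  set ε := min (p - (α + 2)) ((α + 2) / 2) with hε
  have hε0 : 0 < ε := lt_min (by linarith) (by linarith)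
  have h1 : ε ≤ p - (α + 2) := min_le_left _ _
  have h2 : ε ≤ (α + 2) / 2 := min_le_right _ _
  have hc : 0 < (α + 2 - ε) / p := div_pos (by linarith) hp
  have hcp : (α + 2 - ε) / p * p = α + 2 - ε := div_mul_cancel₀ _ hp.ne'
  exact ⟨_, one_sub_cpow_mem_bergmanDisk hα hp hc (by rw [hcp]; linarith),
    symmetricLift_one_sub_cpow_notMem_bergmanBidisk hα hp hc (by rw [add_mul, hcp]; linarith)⟩

theorem theorem11 (α p : ℝ) (hα : -1 < α) (hp : 0 < p) :
    (p < α + 2 →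
      ∃ C : ℝ≥0, ∀ f ∈ bergmanDisk p α,
        symmetricLift f ∈ bergmanBidisk p α ∧
          bergmanBidiskNorm p α (symmetricLift f) ≤ C * bergmanDiskNorm p α f) ∧
    (α + 2 < p →
      ∃ f ∈ bergmanDisk p α, symmetricLift f ∉ bergmanBidisk p α) :=
  ⟨exists_symmetricLift_bounded hα hp, exists_symmetricLift_notMem hα hp⟩
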